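/- Let $p$ be a prime. All modules and algebras below are over $\mathbb{Z}[1/(p-1)!]$. \textbf{The operation $\phi$.} For elements $x_1,\dots,x_k$ of a module $M$ put $$\sigma_p(x_1,\dots,x_k)=\sum_{\substack{0\le j_1,\dots,j_k\le p-1\\ j_1+\dots+j_k=p}}\frac{x_1^{j_1}\cdots x_k^{j_k}}{j_1!\cdots j_k!}\in \mathrm{Sym}^p M,$$ $$\mu_p(y_0,\dots,y_n)=\sigma_p(y_0,-y_1,\dots,(-1)^n y_n)-\sum_{l\text{ odd}}\sigma_p(y_l,-y_l).$$ Let $P^\bullet$ be a cosimplicial module with cofaces $\partial^k$, and let $\mathrm{Sym}^pP^\bullet$ be its levelwise symmetric power. For $x\in P^i$ put $\phi(x)=\mu_p(\partial^0x,\partial^1x,\dots,\partial^{i+1}x)\in \mathrm{Sym}^pP^{i+1}$. Cohomology of a cosimplicial abelian group is that of its cochain complex, with differential $d=\sum_k(-1)^k\partial^k$. \textbf{The spectral sequences.} Let $\mathfrak m^\bullet$ be a nonunital cosimplicial commutative algebra with $\mathfrak m^{\bullet,p+1}=0$, where $\mathfrak m^{\bullet,j}$ is the (levelwise) $j$-th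 power of $\mathfrak m^\bullet$. The filtrations of the cosimplicial abelian groups $\mathfrak m^\bullet$ by the $\mathfrak m^{\bullet,j}$, and $1+\mathfrak m^\bullet$ (formal elements $1+x$ under multiplication) by the $1+\mathfrak m^{\bullet,j}$, give spectral sequences $E_r^{i,j}$ and $E_r^{i,j,\times}$ with differentials $d_r, d_{r,\times}$ of bidegree $(i,j)\mapsto(i+1,j+r)$, starting from $E_1^{i,j}=H^i(\mathfrak m^{\bullet,j}/\mathfrak m^{\bullet,j+1})$ for $1\le j\le p$ in both cases, the $E_1$-pages being identified through $x\leftrightarrow 1+x$. \textbf{Proposition.} \begin{enumerate} \item If $x\in P^i$ is a cocycle, then $\phi(x)$ is a cocycle in $\mathrm{Sym}^pP^{i+1}$. \item If $x,y\in P^i$ are cohomologous cocycles, then $\phi(x),\phi(y)$ are cohomologous. Thus $\phi$ induces a (not necessarily additive) map $\phi\colon H^i(P^\bullet)\to H^{i+1}(\mathrm{Sym}^pP^\bullet)$. \item For $\mathfrak m^\bullet$ as above, the identification of the $E_1$-pages extends to isomorphisms $E_r^{*,*}\cong E_r^{*,*,\times}$ for $1\le r\le p-1$ that commute with the differentials for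 $r<p-1$, the isomorphism on the page $r+1$ being induced by that on the page $r$. Under this identification, for every $i\ge0$, the differentials from $E_{p-1}^{i,1}\subset H^i(\mathfrak m^\bullet/\mathfrak m^{\bullet,2})$ to $E_{p-1}^{i+1,p}$, a quotient of $H^{i+1}(\mathfrak m^{\bullet,p})$, satisfy $$d_{p-1,\times}=d_{p-1}+\phi,$$ where $\phi$ denotes the composite of $\phi\colon H^i(\mathfrak m^\bullet/\mathfrak m^{\bullet,2})\to H^{i+1}(\mathrm{Sym}^p(\mathfrak m^\bullet/\mathfrak m^{\bullet,2}))$, the map to $H^{i+1}(\mathfrak m^{\bullet,p})$ induced by multiplication, and the projection to $E_{p-1}^{i+1,p}$. \end{enumerate} -/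

import Mathlib

open CategoryTheory TensorProduct
open scoped Nat

universe u

set_option linter.unusedSectionVars false

noncomputable section

namespace TruncExp

/-! ### The base ring `ℤ[1/(p-1)!]` -/

/-- The ring `ℤ[1/(p-1)!]`. -/
abbrev ZInv (p : ℕ) : Type := Localization.Away (((p - 1)! : ℕ) : ℤ)

/-! ### Cosimplicial abelian groups and their cohomology -/

section Cohomology

variable (X Y : CosimplicialObject AddCommGrpCat.{u})

/-- The coboundary `∑ₖ (-1)ᵏ ∂ᵏ : Xⁱ → Xⁱ⁺¹` of the cochain complex of a cosimplicial abelian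
group. -/
def cobd (i : ℕ) : X.obj (.mk i) →+ X.obj (.mk (i + 1)) :=
  (AlgebraicTopology.AlternatingCofaceMapComplex.objD X i).hom

theorem cobd_cobd (i : ℕ) (x : X.obj (.mk i)) : cobd X (i + 1) (cobd X i x) = 0 :=
  congrArg (fun f => f.hom x) (AlgebraicTopology.AlternatingCofaceMapComplex.d_squared X i)

theorem cobd_eq_sum (i : ℕ) (x : X.obj (.mk i)) :
    cobd X i x = ∑ k : Fin (i + 2), (-1 : ℤ) ^ (k : ℕ) • (X.δ k).hom x := by
  simp only [cobd, AlgebraicTopology.AlternatingCofaceMapComplex.objD]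
  change AddCommGrpCat.homAddEquiv _ x = _
  rw [map_sum, AddMonoidHom.finsetSum_apply]
  rfl

/-- Cocycles in degree `i`. -/
def cocycles (i : ℕ) : AddSubgroup (X.obj (.mk i)) := (cobd X i).ker

/-- Coboundaries in degree `i` (there are only trivial ones in degree `0`). -/
def coboundaries : ∀ i : ℕ, AddSubgroup (X.obj (.mk i))
  | 0 => ⊥
  | i + 1 => (cobd X i).range

/-- The cohomology group `Hⁱ(X)`. -/
def Coh (i : ℕ) : Type u := cocycles X i ⧸ (coboundaries X i).addSubgroupOf (cocycles X i)

instance (i : ℕ) : AddCommGroup (Coh X i) :=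
  inferInstanceAs (AddCommGroup (cocycles X i ⧸ (coboundaries X i).addSubgroupOf (cocycles X i)))

/-- The cohomology class of a cocycle. -/
def Coh.mk (i : ℕ) : cocycles X i →+ Coh X i :=
  QuotientAddGroup.mk' ((coboundaries X i).addSubgroupOf (cocycles X i))

variable {X Y}

theorem cobd_naturality (f : X ⟶ Y) (i : ℕ) (x : X.obj (.mk i)) :
    cobd Y i ((f.app (.mk i)).hom x) = (f.app (.mk (i + 1))).hom (cobd X i x) := by
  rw [cobd_eq_sum, cobd_eq_sum, map_sum]
  refine Finset.sum_congr rfl fun k _ => ?_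
  rw [map_zsmul]
  congr 1
  exact (congrArg (fun g => g.hom x) (f.naturality (SimplexCategory.δ k))).symm

/-- The map induced on cohomology by a map of cosimplicial abelian groups. -/
def Coh.map (f : X ⟶ Y) (i : ℕ) : Coh X i →+ Coh Y i :=
  QuotientAddGroup.map _ _
    (((f.app (.mk i)).hom.comp (cocycles X i).subtype).codRestrict (cocycles Y i) fun x => by
      have hx : cobd X i x = 0 := x.2
      change cobd Y i ((f.app (.mk i)).hom x) = 0
      rw [cobd_naturality, hx, map_zero])
    (by
      rintro ⟨x, hx'⟩ hx
      change x ∈ coboundaries X i at hx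
      change (f.app (.mk i)).hom x ∈ coboundaries Y i
      cases i with
      | zero =>
        have : x = 0 := hx
        subst this
        rw [map_zero]; exact zero_mem _
      | succ i =>
        obtain ⟨y, rfl⟩ := hx
        exact ⟨(f.app (.mk i)).hom y, cobd_naturality f i y⟩)

end Cohomology

/-! ### The spectral sequence of a filtered cosimplicial abelian group -/

/-- A cosimplicial abelian group with a decreasing filtration by cosimplicial subgroups. -/
structure FilteredCosimplicial where
  X : CosimplicialObject AddCommGrpCat.{u}
  F : ℤ → ∀ n : SimplexCategory, AddSubgroup (X.obj n)
  antitone : ∀ {j j' : ℤ}, j ≤ j' → ∀ n, F j' n ≤ F j n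
  map_mem : ∀ (j : ℤ) {m n : SimplexCategory} (f : m ⟶ n) (x : X.obj m), x ∈ F j m →
    (X.map f).hom x ∈ F j n

namespace FilteredCosimplicial

variable (K : FilteredCosimplicial.{u})

/-- `Z_r^{i,j} = {x ∈ F^j Xⁱ : dx ∈ F^{j+r} Xⁱ⁺¹}`. -/
def Z (r : ℤ) (i : ℕ) (j : ℤ) : AddSubgroup (K.X.obj (.mk i)) :=
  K.F j (.mk i) ⊓ (K.F (j + r) (.mk (i + 1))).comap (cobd K.X i)

/-- `B_r^{i,j} = Z_{r-1}^{i,j+1} + d Z_{r-1}^{i-1,j-r+1}` (the second term is absent for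
`i = 0`). -/
def B (r : ℤ) : ∀ (i : ℕ) (_ : ℤ), AddSubgroup (K.X.obj (.mk i))
  | 0, j => K.Z (r - 1) 0 (j + 1)
  | i + 1, j => K.Z (r - 1) (i + 1) (j + 1) ⊔ (K.Z (r - 1) i (j - r + 1)).map (cobd K.X i)

/-- The page `E_r^{i,j} = Z_r^{i,j} / B_r^{i,j}` of the spectral sequence of the filtration.
Here `i` is the cohomological degree and `j` the filtration. -/
def E (r : ℤ) (i : ℕ) (j : ℤ) : Type u := K.Z r i j ⧸ (K.B r i j).addSubgroupOf (K.Z r i j)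

instance (r : ℤ) (i : ℕ) (j : ℤ) : AddCommGroup (K.E r i j) :=
  inferInstanceAs (AddCommGroup (K.Z r i j ⧸ (K.B r i j).addSubgroupOf (K.Z r i j)))

/-- The class in `E_r^{i,j}` of an element of `Z_r^{i,j}`. -/
def mkE (r : ℤ) (i : ℕ) (j : ℤ) : K.Z r i j →+ K.E r i j :=
  QuotientAddGroup.mk' ((K.B r i j).addSubgroupOf (K.Z r i j))

/-- The differential `d_r : E_r^{i,j} → E_r^{i+1,j+r}`, induced by the coboundary. -/
def dE (r : ℤ) (i : ℕ) (j j' : ℤ) (h : j + r = j') : K.E r i j →+ K.E r (i + 1) j' :=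
  QuotientAddGroup.map _ _
    (((cobd K.X i).comp (K.Z r i j).subtype).codRestrict (K.Z r (i + 1) j') fun x => by
      obtain ⟨x, -, hx⟩ := x
      subst h
      refine ⟨hx, ?_⟩
      change cobd K.X (i + 1) (cobd K.X i x) ∈ K.F (j + r + r) (.mk (i + 1 + 1))
      rw [cobd_cobd]
      exact zero_mem _)
    (by
      subst h
      rintro ⟨x, hx'⟩ hx
      change x ∈ K.B r i j at hx
      change cobd K.X i x ∈ K.B r (i + 1) (j + r)
      have key : ∀ y ∈ K.Z (r - 1) i (j + 1), cobd K.X i y ∈ K.B r (i + 1) (j + r) := by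
        intro y hy
        refine AddSubgroup.mem_sup_right ⟨y, ?_, rfl⟩
        rwa [show j + r - r + 1 = j + 1 by ring]
      cases i with
      | zero => exact key x hx
      | succ i =>
        obtain ⟨y, hy, z, ⟨w, -, rfl⟩, rfl⟩ := AddSubgroup.mem_sup.mp hx
        rw [map_add, cobd_cobd, add_zero]
        exact key y hy)

end FilteredCosimplicial

/-! ### Symmetric powers -/

section SymmetricPower

variable {R : Type} [CommRing R] {ι : Type} {M N L : Type u} [AddCommGroup M] [Module R M]
  [AddCommGroup N] [Module R N] [AddCommGroup L] [Module R L]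

/-- The linear map out of the symmetric power determined by a symmetric multilinear map. -/
def symLift (f : MultilinearMap R (fun _ : ι => M) N)
    (hf : ∀ (e : Equiv.Perm ι) (v : ι → M), f (fun a => v (e a)) = f v) :
    Sym[R] ι M →ₗ[R] N where
  toFun := AddCon.lift (addConGen (SymmetricPower.Rel R ι M))
    (PiTensorProduct.lift f).toAddMonoidHom (AddCon.addConGen_le.2 (by
      rintro _ _ ⟨e, v⟩
      change PiTensorProduct.lift f (PiTensorProduct.tprod R fun a => v a) =
        PiTensorProduct.lift f (PiTensorProduct.tprod R fun a => v (e a))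
      rw [PiTensorProduct.lift.tprod, PiTensorProduct.lift.tprod]
      exact (hf e v).symm))
  map_add' := map_add _
  map_smul' r x := AddCon.induction_on x fun y => (PiTensorProduct.lift f).map_smul r y

theorem symLift_tprod (f : MultilinearMap R (fun _ : ι => M) N)
    (hf : ∀ (e : Equiv.Perm ι) (v : ι → M), f (fun a => v (e a)) = f v) (v : ι → M) :
    symLift f hf (SymmetricPower.tprod R v) = f v :=
  PiTensorProduct.lift.tprod v

theorem symPower_hom_ext {f g : Sym[R] ι M →ₗ[R] N}
    (h : ∀ v, f (SymmetricPower.tprod R v) = g (SymmetricPower.tprod R v)) : f = g :=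
  LinearMap.ext_on_range (SymmetricPower.span_tprod_eq_top R ι M) h

/-- Functoriality of symmetric powers. -/
def symMap (f : M →ₗ[R] N) : Sym[R] ι M →ₗ[R] Sym[R] ι N :=
  symLift ((SymmetricPower.tprod R).compLinearMap fun _ => f)
    fun e v => SymmetricPower.tprod_equiv e fun a => f (v a)

theorem symMap_tprod (f : M →ₗ[R] N) (v : ι → M) :
    symMap f (SymmetricPower.tprod R v) = SymmetricPower.tprod R fun a => f (v a) :=
  symLift_tprod _ _ v

end SymmetricPower

/-- The `p`-th symmetric power functor on `ℤ[1/(p-1)!]`-modules. -/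
def symFunctor (p : ℕ) : ModuleCat.{u} (ZInv p) ⥤ ModuleCat.{u} (ZInv p) where
  obj M := ModuleCat.of (ZInv p) (Sym[ZInv p] (Fin p) M)
  map f := ModuleCat.ofHom (symMap f.hom)
  map_id M := by
    ext1
    exact symPower_hom_ext fun v => by
      simp only [ModuleCat.hom_ofHom]; rw [symMap_tprod]; rfl
  map_comp f g := by
    ext1
    exact symPower_hom_ext fun v => by
      simp only [ModuleCat.hom_ofHom, ModuleCat.hom_comp, LinearMap.comp_apply]
      rw [symMap_tprod, symMap_tprod, symMap_tprod]
      rfl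

/-- The underlying cosimplicial abelian group of a cosimplicial module. -/
abbrev toAb {R : Type} [CommRing R] (P : CosimplicialObject (ModuleCat.{u} R)) :
    CosimplicialObject AddCommGrpCat.{u} :=
  ((CosimplicialObject.whiskering _ _).obj (forget₂ (ModuleCat.{u} R) AddCommGrpCat.{u})).obj P

/-- The map of cosimplicial abelian groups underlying a map of cosimplicial modules. -/
abbrev toAbMap {R : Type} [CommRing R] {P Q : CosimplicialObject (ModuleCat.{u} R)} (f : P ⟶ Q) :
    toAb P ⟶ toAb Q :=
  ((CosimplicialObject.whiskering _ _).obj (forget₂ (ModuleCat.{u} R) AddCommGrpCat.{u})).map f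

/-- The cosimplicial module `Symᵖ P`, the symmetric power being applied levelwise. -/
abbrev symPow (p : ℕ) (P : CosimplicialObject (ModuleCat.{u} (ZInv p))) :
    CosimplicialObject (ModuleCat.{u} (ZInv p)) :=
  ((CosimplicialObject.whiskering _ _).obj (symFunctor p)).obj P

/-! ### The operations `σ_p`, `μ_p` and `φ` -/

section Operations

variable (p : ℕ) {M : Type u} [AddCommGroup M] [Module (ZInv p) M]

/-- The monomial `x₁^{j₁} ⋯ x_k^{j_k}` in `Symᵖ M`, where `j_l` is the multiplicity of `l` in the
multiset `s` of size `p`. -/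
def symMonomial {k : ℕ} (x : Fin k → M) (s : Sym (Fin k) p) : Sym[ZInv p] (Fin p) M :=
  SymmetricPower.tprod (ZInv p) fun a : Fin p =>
    x (s.1.toList.get (Fin.cast (by rw [Multiset.length_toList, s.2]) a))

/-- `σ_p(x₁, …, x_k) = ∑ x₁^{j₁} ⋯ x_k^{j_k} / (j₁! ⋯ j_k!)`, the sum being over all exponents
`0 ≤ j_l ≤ p - 1` with `j₁ + ⋯ + j_k = p`. The exponents are encoded as the multiplicities of a
multiset of size `p`; the factorials that occur are units of `ℤ[1/(p-1)!]`. -/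
def sigma {k : ℕ} (x : Fin k → M) : Sym[ZInv p] (Fin p) M :=
  ∑ s : Sym (Fin k) p with ∀ l, s.1.count l ≤ p - 1,
    (∏ l, Ring.inverse (((s.1.count l)! : ℕ) : ZInv p)) • symMonomial p x s

/-- `μ_p(y₀, …, yₙ) = σ_p(y₀, -y₁, …, (-1)ⁿ yₙ) - ∑_{l odd} σ_p(y_l, -y_l)`. -/
def mu {k : ℕ} (y : Fin k → M) : Sym[ZInv p] (Fin p) M :=
  sigma p (fun l => (-1 : ℤ) ^ (l : ℕ) • y l) -
    ∑ l : Fin k with Odd l.val, sigma p ![y l, -y l]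

/-- `φ(x) = μ_p(∂⁰x, ∂¹x, …, ∂ⁱ⁺¹x) ∈ Symᵖ Pⁱ⁺¹` for a cochain `x ∈ Pⁱ`. -/
def phi (P : CosimplicialObject (ModuleCat.{u} (ZInv p))) (i : ℕ) (x : (toAb P).obj (.mk i)) :
    (toAb (symPow p P)).obj (.mk (i + 1)) :=
  mu p (M := P.obj (.mk (i + 1))) fun k : Fin (i + 2) => (P.δ k).hom x

variable {p} in
/-- The operation `Hⁱ(P) → Hⁱ⁺¹(Symᵖ P)` induced by `φ`, once `φ` is known to preserve cocycles
and the relation of being cohomologous. It need not be additive. -/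
def phiCoh {P : CosimplicialObject (ModuleCat.{u} (ZInv p))} {i : ℕ}
    (h₁ : ∀ x ∈ cocycles (toAb P) i, phi p P i x ∈ cocycles (toAb (symPow p P)) (i + 1))
    (h₂ : ∀ x ∈ cocycles (toAb P) i, ∀ y ∈ cocycles (toAb P) i, x - y ∈ coboundaries (toAb P) i →
      phi p P i x - phi p P i y ∈ coboundaries (toAb (symPow p P)) (i + 1)) :
    Coh (toAb P) i → Coh (toAb (symPow p P)) (i + 1) :=
  Quotient.map' (fun x => ⟨phi p P i x, h₁ x x.2⟩) (by
    intro x y hxy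
    rw [QuotientAddGroup.leftRel_apply] at hxy ⊢
    have h : (-x + y : cocycles (toAb P) i).1 ∈ coboundaries (toAb P) i := hxy
    have h' : y.1 - x.1 ∈ coboundaries (toAb P) i := by
      rwa [sub_eq_neg_add]
    have h'' := h₂ y y.2 x x.2 h'
    rw [sub_eq_neg_add] at h''
    exact h'')

end Operations

/-! ### Nonunital commutative algebras -/

/-- Nonunital commutative algebras over a commutative ring `R`. -/
structure NUCommAlg (R : Type) [CommRing R] where
  carrier : Type u
  [ring : NonUnitalCommRing carrier]
  [module : Module R carrier]
  [isScalarTower : IsScalarTower R carrier carrier]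
  [smulCommClass : SMulCommClass R carrier carrier]

/-- The linear map underlying a homomorphism of nonunital algebras. -/
def nuLin {R : Type} [CommRing R] {A B : Type u} [NonUnitalCommRing A] [Module R A]
    [NonUnitalCommRing B] [Module R B] (f : A →ₙₐ[R] B) : A →ₗ[R] B where
  toFun := f
  map_add' := map_add f
  map_smul' := map_smul f

namespace NUCommAlg

variable {R : Type} [CommRing R]

instance : CoeSort (NUCommAlg.{u} R) (Type u) := ⟨NUCommAlg.carrier⟩

attribute [instance] NUCommAlg.ring NUCommAlg.module NUCommAlg.isScalarTower
  NUCommAlg.smulCommClass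

instance : Category (NUCommAlg.{u} R) where
  Hom A B := A →ₙₐ[R] B
  id A := NonUnitalAlgHom.id R A
  comp f g := NonUnitalAlgHom.comp g f

/-- The homomorphism of nonunital algebras underlying a morphism. -/
def algHom {A B : NUCommAlg.{u} R} (f : A ⟶ B) : A →ₙₐ[R] B := f

/-- The linear map underlying a morphism. -/
abbrev linMap {A B : NUCommAlg.{u} R} (f : A ⟶ B) : A →ₗ[R] B := nuLin (algHom f)

end NUCommAlg

section Powers

variable (R : Type) [CommRing R] (A : Type u) [NonUnitalCommRing A] [Module R A]
  [IsScalarTower R A A] [SMulCommClass R A A]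

/-- The `j`-th power `Aʲ` of a nonunital commutative algebra: the span of the `j`-fold products.
By convention `A⁰ = A`. -/
def nuPow : ℕ → Submodule R A
  | 0 => ⊤
  | 1 => ⊤
  | j + 2 => Submodule.span R {z | ∃ x : A, ∃ y ∈ nuPow (j + 1), x * y = z}

variable {R A}

theorem mul_mem_nuPow_succ {j : ℕ} (hj : 1 ≤ j) (x : A) {y : A} (hy : y ∈ nuPow R A j) :
    x * y ∈ nuPow R A (j + 1) := by
  obtain ⟨j, rfl⟩ := Nat.exists_eq_add_of_le' hj
  exact Submodule.subset_span ⟨x, y, hy, rfl⟩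

theorem nuPow_succ_le (j : ℕ) : nuPow R A (j + 1) ≤ nuPow R A j := by
  induction j with
  | zero => exact le_top
  | succ j ih =>
    cases j with
    | zero => exact le_top
    | succ j =>
      refine Submodule.span_le.2 ?_
      rintro _ ⟨x, y, hy, rfl⟩
      exact Submodule.subset_span ⟨x, y, ih hy, rfl⟩

theorem nuPow_antitone : Antitone (nuPow R A) := antitone_nat_of_succ_le nuPow_succ_le

theorem mul_mem_nuPow (j : ℕ) (x : A) {y : A} (hy : y ∈ nuPow R A j) : x * y ∈ nuPow R A j := by
  cases j with
  | zero => trivial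
  | succ j => exact nuPow_succ_le _ (mul_mem_nuPow_succ (Nat.succ_pos j) x hy)

theorem map_mem_nuPow {B : Type u} [NonUnitalCommRing B] [Module R B]
    [IsScalarTower R B B] [SMulCommClass R B B] (f : A →ₙₐ[R] B) (j : ℕ) {x : A}
    (hx : x ∈ nuPow R A j) : f x ∈ nuPow R B j := by
  induction j generalizing x with
  | zero => trivial
  | succ j ih =>
    cases j with
    | zero => trivial
    | succ j =>
      refine Submodule.span_induction (p := fun x _ => f x ∈ nuPow R B (j + 2)) ?_ ?_ ?_ ?_ hx
      · rintro _ ⟨x, y, hy, rfl⟩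
        rw [map_mul]
        exact mul_mem_nuPow_succ (Nat.succ_pos j) _ (ih hy)
      · rw [map_zero]; exact zero_mem _
      · intro x y _ _ hx hy
        rw [map_add]; exact add_mem hx hy
      · intro r x _ hx
        rw [map_smul]; exact Submodule.smul_mem _ r hx

end Powers

/-! ### The multiplication map `Symᵖ(A/A²) → Aᵖ` -/

section Multiplication

variable {R : Type} [CommRing R] {A : Type u} [NonUnitalCommRing A] [Module R A]
  [IsScalarTower R A A] [SMulCommClass R A A]

variable (R A) in
/-- The product of `n ≥ 1` elements of a nonunital commutative algebra (computed in its
unitization), as a multilinear map. -/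
def nuProd (n : ℕ) : MultilinearMap R (fun _ : Fin n => A) A :=
  (Unitization.sndHom R R A).compMultilinearMap
    ((MultilinearMap.mkPiAlgebra R (Fin n) (Unitization R A)).compLinearMap
      fun _ => Unitization.inrHom R R A)

theorem nuProd_apply (n : ℕ) (v : Fin n → A) :
    nuProd R A n v = (∏ a, (v a : Unitization R A)).snd := rfl

theorem inr_mul_prod {ι : Type} [DecidableEq ι] (t : Finset ι) (v : ι → A) {m : ℕ} (hm : 1 ≤ m)
    {x : A} (hx : x ∈ nuPow R A m) :
    ∃ y ∈ nuPow R A (m + t.card), (x : Unitization R A) * ∏ a ∈ t, (v a : Unitization R A) = y := by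
  induction t using Finset.induction_on with
  | empty => exact ⟨x, by simpa using hx, by simp⟩
  | insert b t hb ih =>
    obtain ⟨y, hy, h⟩ := ih
    refine ⟨v b * y, ?_, ?_⟩
    · rw [Finset.card_insert_of_notMem hb, ← add_assoc]
      exact mul_mem_nuPow_succ (by omega) _ hy
    · rw [Finset.prod_insert hb, mul_left_comm, h, Unitization.inr_mul]

theorem nuProd_mem_of_mem {n : ℕ} (v : Fin n → A) (a : Fin n) {m : ℕ} (hm : 1 ≤ m)
    (ha : v a ∈ nuPow R A m) : nuProd R A n v ∈ nuPow R A (m + (n - 1)) := by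
  obtain ⟨y, hy, h⟩ := inr_mul_prod (Finset.univ.erase a) v hm ha
  rw [Finset.mul_prod_erase _ (fun a => (v a : Unitization R A)) (Finset.mem_univ a)] at h
  rw [nuProd_apply, h, Unitization.snd_inr]
  simpa using hy

theorem nuProd_mem (n : ℕ) (v : Fin n → A) : nuProd R A n v ∈ nuPow R A n := by
  cases n with
  | zero => trivial
  | succ n =>
    have := nuProd_mem_of_mem (R := R) v 0 le_rfl (by trivial)
    rwa [show 1 + (n + 1 - 1) = n + 1 by omega] at this

theorem nuProd_perm {n : ℕ} (e : Equiv.Perm (Fin n)) (v : Fin n → A) :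
    nuProd R A n (fun a => v (e a)) = nuProd R A n v := by
  rw [nuProd_apply, nuProd_apply, Equiv.prod_comp e fun a => (v a : Unitization R A)]

theorem map_nuProd {B : Type u} [NonUnitalCommRing B] [Module R B]
    [IsScalarTower R B B] [SMulCommClass R B B] (f : A →ₙₐ[R] B) {n : ℕ} (v : Fin n → A) :
    f (nuProd R A n v) = nuProd R B n fun a => f (v a) := by
  let g : Unitization R A →ₐ[R] Unitization R B :=
    Unitization.lift ((Unitization.inrNonUnitalAlgHom R B).comp f)
  have hg : ∀ a : A, g (a : Unitization R A) = ((f a : B) : Unitization R B) := fun a => by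
    simp [g]
  have hs : ∀ z, (g z).snd = f z.snd := fun z => by
    simp [g, Unitization.lift_apply, NonUnitalAlgHom.toAlgHom, Unitization.algebraMap_eq_inl]
  rw [nuProd_apply, nuProd_apply, ← hs, map_prod]
  simp only [hg]

/-- Two families that agree modulo `A²` have the same `n`-fold product, if `Aⁿ⁺¹ = 0`. -/
theorem nuProd_congr {n : ℕ} (h : nuPow R A (n + 1) = ⊥) (v w : Fin n → A)
    (hvw : ∀ a, v a - w a ∈ nuPow R A 2) : nuProd R A n v = nuProd R A n w := by
  have key : ∀ s : Finset (Fin n), nuProd R A n (s.piecewise v w) = nuProd R A n w := by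
    intro s
    induction s using Finset.induction_on with
    | empty => simp
    | insert b s hb ih =>
      rw [← ih, Finset.piecewise_insert, ← sub_eq_zero]
      have h1 : s.piecewise v w = Function.update (s.piecewise v w) b (w b) := by
        rw [eq_comm, Function.update_eq_self_iff, Finset.piecewise_eq_of_notMem _ _ _ hb]
      conv_lhs => enter [2]; rw [h1]
      rw [← MultilinearMap.map_update_sub]
      have := nuProd_mem_of_mem (R := R) (Function.update (s.piecewise v w) b (v b - w b)) b
        one_le_two (by simpa using hvw b)
      have hn := b.pos
      rw [show 2 + (n - 1) = n + 1 by omega, h] at this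
      exact this
  simpa using key Finset.univ

/-- The multilinear map `(A/A²)ⁿ → Aⁿ` given by multiplication, if `Aⁿ⁺¹ = 0`. -/
def nuProdQuot {n : ℕ} (h : nuPow R A (n + 1) = ⊥) :
    MultilinearMap R (fun _ : Fin n => A ⧸ nuPow R A 2) (nuPow R A n) where
  toFun v := ⟨nuProd R A n fun a => (v a).out, nuProd_mem n _⟩
  map_update_add' {d} v a x y := by
    obtain rfl : d = instDecidableEqFin n := Subsingleton.elim _ _
    ext
    have hout : ∀ z : A ⧸ nuPow R A 2, Submodule.Quotient.mk z.out = z := Quotient.out_eq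
    have hu : ∀ z : A ⧸ nuPow R A 2, (nuProd R A n fun b => (Function.update v a z b).out) =
        nuProd R A n (Function.update (fun b => (v b).out) a z.out) := fun z => by
      congr 1; ext b
      by_cases hb : b = a
      · subst hb; simp
      · simp [hb]
    change (nuProd R A n fun b => (Function.update v a (x + y) b).out) =
      (nuProd R A n fun b => (Function.update v a x b).out) +
        nuProd R A n fun b => (Function.update v a y b).out
    rw [hu, hu, hu, ← MultilinearMap.map_update_add]
    refine nuProd_congr h _ _ fun b => ?_
    rw [← Submodule.Quotient.eq]
    by_cases hb : b = a
    · subst hb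
      simp [hout]
    · simp [hb]
  map_update_smul' {d} v a r x := by
    obtain rfl : d = instDecidableEqFin n := Subsingleton.elim _ _
    ext
    have hout : ∀ z : A ⧸ nuPow R A 2, Submodule.Quotient.mk z.out = z := Quotient.out_eq
    have hu : ∀ z : A ⧸ nuPow R A 2, (nuProd R A n fun b => (Function.update v a z b).out) =
        nuProd R A n (Function.update (fun b => (v b).out) a z.out) := fun z => by
      congr 1; ext b
      by_cases hb : b = a
      · subst hb; simp
      · simp [hb]
    change (nuProd R A n fun b => (Function.update v a (r • x) b).out) =
      r • (nuProd R A n fun b => (Function.update v a x b).out)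
    rw [hu, hu, ← MultilinearMap.map_update_smul]
    refine nuProd_congr h _ _ fun b => ?_
    rw [← Submodule.Quotient.eq]
    by_cases hb : b = a
    · subst hb
      simp [hout]
    · simp [hb]

theorem nuProdQuot_mk {n : ℕ} (h : nuPow R A (n + 1) = ⊥) (v : Fin n → A) :
    (nuProdQuot h (fun a => Submodule.Quotient.mk (v a)) : A) = nuProd R A n v :=
  nuProd_congr h _ _ fun a => by
    rw [← Submodule.Quotient.eq]
    exact Quotient.out_eq _

/-- The multiplication map `Symⁿ(A/A²) → Aⁿ`, if `Aⁿ⁺¹ = 0`. -/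
def symMul {n : ℕ} (h : nuPow R A (n + 1) = ⊥) :
    Sym[R] (Fin n) (A ⧸ nuPow R A 2) →ₗ[R] nuPow R A n :=
  symLift (nuProdQuot h) fun e v => Subtype.ext (nuProd_perm e fun a => (v a).out)

/-- The multiplication map sends a product of classes `x̄₁ ⋯ x̄ₙ` to `x₁ ⋯ xₙ`. -/
theorem symMul_tprod_mk {n : ℕ} (h : nuPow R A (n + 1) = ⊥) (v : Fin n → A) :
    (symMul h (SymmetricPower.tprod R fun a => Submodule.Quotient.mk (v a)) : A) =
      nuProd R A n v := by
  rw [symMul, symLift_tprod, nuProdQuot_mk]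

/-- Naturality of the multiplication map. -/
theorem symMul_naturality {B : Type u} [NonUnitalCommRing B] [Module R B]
    [IsScalarTower R B B] [SMulCommClass R B B] (f : A →ₙₐ[R] B) {n : ℕ}
    (hA : nuPow R A (n + 1) = ⊥) (hB : nuPow R B (n + 1) = ⊥) :
    symMul hB ∘ₗ symMap (Submodule.mapQ (nuPow R A 2) (nuPow R B 2) (nuLin f)
        fun _ hx => map_mem_nuPow f 2 hx) =
      (nuLin f).restrict (fun _ hx => map_mem_nuPow f n hx) ∘ₗ symMul hA := by
  refine symPower_hom_ext fun v => ?_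
  obtain ⟨w, rfl⟩ : ∃ w : Fin n → A, v = fun a => Submodule.Quotient.mk (w a) :=
    ⟨fun a => (v a).out, funext fun a => (Quotient.out_eq (v a)).symm⟩
  apply Subtype.ext
  rw [LinearMap.comp_apply, LinearMap.comp_apply, symMap_tprod]
  refine (symMul_tprod_mk hB fun a => f (w a)).trans ((map_nuProd f w).symm.trans ?_)
  exact congrArg f (symMul_tprod_mk hA w).symm

end Multiplication

/-! ### Functors on nonunital commutative algebras -/

section Functors

variable (R : Type) [CommRing R]

/-- The underlying module of a nonunital algebra. -/
def underlying : NUCommAlg.{u} R ⥤ ModuleCat.{u} R where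
  obj A := ModuleCat.of R A
  map f := ModuleCat.ofHom (NUCommAlg.linMap f)

/-- The functor `A ↦ Aʲ`. -/
def powFunctor (j : ℕ) : NUCommAlg.{u} R ⥤ ModuleCat.{u} R where
  obj A := ModuleCat.of R (nuPow R A j)
  map f := ModuleCat.ofHom ((NUCommAlg.linMap f).restrict
    fun _ hx => map_mem_nuPow (NUCommAlg.algHom f) j hx)

/-- The functor `A ↦ A/A²`. -/
def indecFunctor : NUCommAlg.{u} R ⥤ ModuleCat.{u} R where
  obj A := ModuleCat.of R (A ⧸ nuPow R A 2)
  map f := ModuleCat.ofHom (Submodule.mapQ _ _ (NUCommAlg.linMap f)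
    fun _ hx => map_mem_nuPow (NUCommAlg.algHom f) 2 hx)
  map_id A := by
    ext1
    exact Submodule.linearMap_qext _ rfl
  map_comp f g := by
    ext1
    exact Submodule.linearMap_qext _ rfl

end Functors

section OnePlus

/-- `PreQuasiregular A` is the monoid `1 + A` of formal elements `1 + x` with `x ∈ A`, multiplied
by the rule `(1 + x)(1 + y) = 1 + (x + y + xy)`. -/
instance {A : Type u} [NonUnitalCommRing A] : CommMonoid (PreQuasiregular A) where
  mul_comm x y := by
    apply PreQuasiregular.equiv.symm.injective
    change y.val + x.val + x.val * y.val = x.val + y.val + y.val * x.val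
    rw [add_comm x.val, mul_comm]

/-- The group `1 + A`, written additively. It consists of the invertible elements of the monoid of
formal elements `1 + x`, `x ∈ A`; these are all the elements when `A` is nilpotent. -/
abbrev OnePlus (A : Type u) [NonUnitalCommRing A] : Type u := Additive (PreQuasiregular A)ˣ

/-- The element `x` corresponding to `1 + x`. -/
def OnePlus.val {A : Type u} [NonUnitalCommRing A] (g : OnePlus A) : A := g.toMul.val.val

variable {R : Type} [CommRing R]

/-- The map `1 + x ↦ 1 + f(x)` on formal elements. -/
def preQuasiregularMap {A B : Type u} [NonUnitalCommRing A] [Module R A] [NonUnitalCommRing B]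
    [Module R B] (f : A →ₙₐ[R] B) : PreQuasiregular A →* PreQuasiregular B where
  toFun x := ⟨f x.val⟩
  map_one' := congrArg PreQuasiregular.mk (map_zero f)
  map_mul' x y := congrArg PreQuasiregular.mk (by
    change f (y.val + x.val + x.val * y.val) = f y.val + f x.val + f x.val * f y.val
    rw [map_add, map_add, map_mul])

variable (R) in
/-- The functor `A ↦ 1 + A`. -/
def onePlusFunctor : NUCommAlg.{u} R ⥤ AddCommGrpCat.{u} where
  obj A := AddCommGrpCat.of (OnePlus A)
  map f := AddCommGrpCat.ofHom
    (MonoidHom.toAdditive (Units.map (preQuasiregularMap (NUCommAlg.algHom f))))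

/-- The subgroup `1 + Aʲ` of `1 + A`. -/
def onePlusPow (R : Type) [CommRing R] (A : Type u) [NonUnitalCommRing A] [Module R A]
    [IsScalarTower R A A] [SMulCommClass R A A] (j : ℕ) : AddSubgroup (OnePlus A) where
  carrier := {g | g.val ∈ nuPow R A j}
  zero_mem' := zero_mem (nuPow R A j)
  add_mem' {g h} hg hh :=
    add_mem (add_mem hh hg) (mul_mem_nuPow j _ hh)
  neg_mem' {g} hg := by
    have h := PreQuasiregular.inv_add_add_mul_eq_zero g.toMul
    change (-g).val + g.val + g.val * (-g).val = 0 at h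
    have h' : (-g).val = -(g.val + (-g).val * g.val) := by
      rw [mul_comm, eq_neg_iff_add_eq_zero, ← add_assoc]
      exact h
    change (-g).val ∈ nuPow R A j
    rw [h']
    exact neg_mem (add_mem hg (mul_mem_nuPow j _ hg))

end OnePlus

/-! ### Cosimplicial nonunital commutative algebras -/

section Cosimplicial

variable {R : Type} [CommRing R] (𝔪 : CosimplicialObject (NUCommAlg.{u} R))

/-- The cosimplicial module `𝔪^{•,j}`. -/
abbrev powCosimplicial (j : ℕ) : CosimplicialObject (ModuleCat.{u} R) :=
  ((CosimplicialObject.whiskering _ _).obj (powFunctor R j)).obj 𝔪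

/-- The cosimplicial module `𝔪^• / 𝔪^{•,2}`. -/
abbrev indec : CosimplicialObject (ModuleCat.{u} R) :=
  ((CosimplicialObject.whiskering _ _).obj (indecFunctor R)).obj 𝔪

/-- The cosimplicial abelian group `𝔪^•` with the filtration by the powers `𝔪^{•,j}`
(and `F^j = 𝔪^•` for `j ≤ 1`). -/
def additiveFiltration : FilteredCosimplicial.{u} where
  X := toAb (((CosimplicialObject.whiskering _ _).obj (underlying R)).obj 𝔪)
  F j n := (nuPow R (𝔪.obj n) j.toNat).toAddSubgroup
  antitone h n := fun _ hx =>
    nuPow_antitone (R := R) (A := 𝔪.obj n) (Int.toNat_le_toNat h) hx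
  map_mem j _ _ f _ hx := map_mem_nuPow (NUCommAlg.algHom (𝔪.map f)) j.toNat hx

/-- The cosimplicial abelian group `1 + 𝔪^•` with the filtration by the `1 + 𝔪^{•,j}`
(and `F^j = 1 + 𝔪^•` for `j ≤ 1`). -/
def multiplicativeFiltration : FilteredCosimplicial.{u} where
  X := ((CosimplicialObject.whiskering _ _).obj (onePlusFunctor R)).obj 𝔪
  F j n := onePlusPow R (𝔪.obj n) j.toNat
  antitone h n := fun _ hg =>
    nuPow_antitone (R := R) (A := 𝔪.obj n) (Int.toNat_le_toNat h) hg
  map_mem j _ _ f _ hx := map_mem_nuPow (NUCommAlg.algHom (𝔪.map f)) j.toNat hx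

/-- The map of cosimplicial modules `Symᵖ(𝔪^•/𝔪^{•,2}) → 𝔪^{•,p}` given by multiplication. -/
def mulMap {p : ℕ} (𝔪 : CosimplicialObject (NUCommAlg.{u} (ZInv p)))
    (h : ∀ n, nuPow (ZInv p) (𝔪.obj n) (p + 1) = ⊥) :
    symPow p (indec 𝔪) ⟶ powCosimplicial 𝔪 p where
  app n := ModuleCat.ofHom (symMul (h n))
  naturality m n f := by
    ext1
    exact symMul_naturality (NUCommAlg.algHom (𝔪.map f)) (h m) (h n)

/-- The quotient map `𝔪^• → 𝔪^• / 𝔪^{•,2}`. -/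
def toIndec : (additiveFiltration 𝔪).X ⟶ toAb (indec 𝔪) where
  app n := (forget₂ (ModuleCat.{u} R) AddCommGrpCat.{u}).map
    (ModuleCat.ofHom (Submodule.mkQ (nuPow R (𝔪.obj n) 2)))
  naturality _ _ _ := rfl

/-- The inclusion `𝔪^{•,j} → 𝔪^•`. -/
def ofPow (j : ℕ) : toAb (powCosimplicial 𝔪 j) ⟶ (additiveFiltration 𝔪).X where
  app n := (forget₂ (ModuleCat.{u} R) AddCommGrpCat.{u}).map
    (ModuleCat.ofHom (Submodule.subtype (nuPow R (𝔪.obj n) j)))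
  naturality _ _ _ := rfl

/-- The inclusion `E_r^{i,1} → Hⁱ(𝔪^•/𝔪^{•,2})` (for `r ≥ 1`), sending the class of `x` to the
class of `x` modulo `𝔪^{•,2}`. -/
def bottomEdge (r : ℤ) (hr : 1 ≤ r) (i : ℕ) :
    (additiveFiltration 𝔪).E r i 1 →+ Coh (toAb (indec 𝔪)) i :=
  QuotientAddGroup.map _ _
    ((((toIndec 𝔪).app (.mk i)).hom.comp ((additiveFiltration 𝔪).Z r i 1).subtype).codRestrict
      (cocycles (toAb (indec 𝔪)) i) fun x => by
        obtain ⟨x, -, hx⟩ := x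
        change cobd _ i (((toIndec 𝔪).app (.mk i)).hom x) = 0
        rw [cobd_naturality]
        refine (Submodule.Quotient.mk_eq_zero _).2 ?_
        exact (additiveFiltration 𝔪).antitone (show (2 : ℤ) ≤ 1 + r by omega) _ hx)
    (by
      rintro ⟨x, hx'⟩ hx
      change x ∈ (additiveFiltration 𝔪).B r i 1 at hx
      change ((toIndec 𝔪).app (.mk i)).hom x ∈ coboundaries (toAb (indec 𝔪)) i
      have key : ∀ i, ∀ y ∈ (additiveFiltration 𝔪).Z (r - 1) i (1 + 1),
          ((toIndec 𝔪).app (.mk i)).hom y = 0 := fun i y hy =>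
        (Submodule.Quotient.mk_eq_zero _).2 hy.1
      cases i with
      | zero => exact key _ x hx
      | succ i =>
        obtain ⟨y, hy, z, ⟨w, -, rfl⟩, rfl⟩ := AddSubgroup.mem_sup.mp hx
        rw [map_add, key _ y hy, zero_add]
        exact ⟨((toIndec 𝔪).app (.mk i)).hom w, cobd_naturality (toIndec 𝔪) i w⟩)

/-- The quotient map `Hⁱ(𝔪^{•,j}) → E_r^{i,j}` (for `r ≥ 1`) when `𝔪^{•,j+1} = 0`. -/
def topEdge (r : ℤ) (hr : 1 ≤ r) (i j : ℕ) :
    Coh (toAb (powCosimplicial 𝔪 j)) i →+ (additiveFiltration 𝔪).E r i j :=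
  QuotientAddGroup.map _ _
    ((((ofPow 𝔪 j).app (.mk i)).hom.comp (cocycles (toAb (powCosimplicial 𝔪 j)) i).subtype).codRestrict
      ((additiveFiltration 𝔪).Z r i j) fun x => by
        obtain ⟨x, hx⟩ := x
        refine ⟨x.2, ?_⟩
        change cobd _ i (((ofPow 𝔪 j).app (.mk i)).hom x) ∈
          (additiveFiltration 𝔪).F (j + r) (.mk (i + 1))
        have hx : cobd _ i x = 0 := hx
        rw [cobd_naturality, hx, map_zero]
        exact zero_mem _)
    (by
      rintro ⟨x, hx'⟩ hx
      change x ∈ coboundaries _ i at hx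
      change ((ofPow 𝔪 j).app (.mk i)).hom x ∈ (additiveFiltration 𝔪).B r i j
      cases i with
      | zero =>
        have : x = 0 := hx
        subst this
        rw [map_zero]
        exact zero_mem _
      | succ i =>
        obtain ⟨w, rfl⟩ := hx
        refine AddSubgroup.mem_sup_right ⟨((ofPow 𝔪 j).app (.mk i)).hom w, ⟨?_, ?_⟩,
          cobd_naturality (ofPow 𝔪 j) i w⟩
        · exact (additiveFiltration 𝔪).antitone (show (j : ℤ) - r + 1 ≤ j by omega) _ w.2
        · change cobd _ i (((ofPow 𝔪 j).app (.mk i)).hom w) ∈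
            (additiveFiltration 𝔪).F (j - r + 1 + (r - 1)) (.mk (i + 1))
          rw [cobd_naturality, show (j : ℤ) - r + 1 + (r - 1) = j by ring]
          exact (cobd (toAb (powCosimplicial 𝔪 j)) i w).2)

end Cosimplicial

/-- The identification of the pages `E_r` and `E_r^×`, for `1 ≤ r ≤ N`, of the spectral sequences
of `𝔪^•` and `1 + 𝔪^•`: on the first page it is `x ↦ 1 + x`, it is compatible with the differentials
`d_r` for `r < N`, and for `r < N` its value on the page `E_{r+1} = H(E_r, d_r)` is induced by its
value on the page `E_r`. These conditions determine it uniquely. -/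
structure PageIdentification {R : Type} [CommRing R] (𝔪 : CosimplicialObject (NUCommAlg.{u} R))
    (N : ℤ) where
  equiv : ∀ (r : ℤ), 1 ≤ r → r ≤ N → ∀ (i : ℕ) (j : ℤ),
    (additiveFiltration 𝔪).E r i j ≃+ (multiplicativeFiltration 𝔪).E r i j
  first : ∀ (h : 1 ≤ N) (i : ℕ) (j : ℤ) (a : (additiveFiltration 𝔪).Z 1 i j)
    (b : (multiplicativeFiltration 𝔪).Z 1 i j), OnePlus.val (A := 𝔪.obj (.mk i)) b.1 = a.1 →
      equiv 1 le_rfl h i j ((additiveFiltration 𝔪).mkE 1 i j a) =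
        (multiplicativeFiltration 𝔪).mkE 1 i j b
  comm : ∀ (r : ℤ) (h₁ : 1 ≤ r) (h₂ : r < N) (i : ℕ) (j j' : ℤ) (hj : j + r = j')
    (e : (additiveFiltration 𝔪).E r i j),
      equiv r h₁ h₂.le (i + 1) j' ((additiveFiltration 𝔪).dE r i j j' hj e) =
        (multiplicativeFiltration 𝔪).dE r i j j' hj (equiv r h₁ h₂.le i j e)
  next : ∀ (r : ℤ) (h₁ : 1 ≤ r) (h₂ : r + 1 ≤ N) (i : ℕ) (j : ℤ) (a b)
    (ha : a ∈ (additiveFiltration 𝔪).Z r i j) (ha' : a ∈ (additiveFiltration 𝔪).Z (r + 1) i j)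
    (hb : b ∈ (multiplicativeFiltration 𝔪).Z r i j)
    (hb' : b ∈ (multiplicativeFiltration 𝔪).Z (r + 1) i j),
      equiv r h₁ (by omega) i j ((additiveFiltration 𝔪).mkE r i j ⟨a, ha⟩) =
          (multiplicativeFiltration 𝔪).mkE r i j ⟨b, hb⟩ →
        equiv (r + 1) (by omega) h₂ i j ((additiveFiltration 𝔪).mkE (r + 1) i j ⟨a, ha'⟩) =
          (multiplicativeFiltration 𝔪).mkE (r + 1) i j ⟨b, hb'⟩

end TruncExp

end

namespace TruncExp

/-! ### Symmetric powers and polynomials -/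

/-! The bridge between `𝔪` and `1 + 𝔪` is the truncated exponential `e(x) = ∑_{n<p} xⁿ/n!`. Write
`A` for one level of `𝔪`. Since `Aᵖ⁺¹ = 0`, multiplying two truncated exponentials loses only the
mixed terms of degree `p`, and these are exactly `σ_p`: `e(x) e(y) = e(x + y)(1 + σ_p(x, y)) = e(x +
y + σ_p(x, y))`. Taking the alternating product over the cofaces, where inverting `e(y)` costs a
factor `1 + σ_p(y, -y)`, gives `d^× e(x) = e(dx + φ(x))` (`nilExp_add`,
`sum_neg_one_pow_smul_nilExp`, `cobd_algExp`).

The map `e` is a bijection that preserves the filtrations and agrees with `x ↦ 1 + x` to leading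
order. The errors `σ_p` and `φ` are products of `p` elements that depend only on classes modulo
`A²`, so they raise filtration by `p - 1`. A purely formal argument about filtered complexes
(`Comparison`) then shows that `e` identifies the pages `E_r` for `r ≤ p - 1` and commutes with
`d_r` for `r < p - 1`. For `r = p - 1` the error survives, and it is `φ`
(`Comparison.dE_pageEquiv`).

The statements about `φ` on cohomology rest on `p! φ(x) = (dx)ᵖ - d(xᵖ)` (`factorial_smul_phi`). Up
to the factor `p!`, it gives `dφ(x) = -φ(dx)` and an explicit cochain bounding `φ(y + dw) - φ(y)`.
Since `p` is not inverted, `p!` can be cancelled only when `Symᵖ` has no `p!`-torsion. This holds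
for free modules, whose symmetric powers embed in polynomial rings over the domain `ℤ[1/(p-1)!]`.
The general case follows by naturality, after covering `P` by the cosimplicial module that is
levelwise free on the underlying sets. -/

theorem exists_perm_of_map_univ_eq {n : ℕ} {X : Type*} {f g : Fin n → X}
    (h : Finset.univ.val.map f = Finset.univ.val.map g) :
    ∃ e : Equiv.Perm (Fin n), ∀ a, g (e a) = f a := by
  classical
  have hc : ∀ c : X, Nonempty ({a // f a = c} ≃ {a // g a = c}) := fun c => by
    refine ⟨Fintype.equivOfCardEq ?_⟩
    have := congrArg (Multiset.count c) h
    simp only [Multiset.count_map, ← Finset.filter_val, Finset.card_val] at this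
    rw [Fintype.card_subtype, Fintype.card_subtype]
    simpa only [eq_comm] using this
  exact ⟨Equiv.ofFiberEquiv fun c => (hc c).some, fun a => Equiv.ofFiberEquiv_map _ a⟩

section Polynomial

variable {R : Type} [CommRing R] {n : ℕ} {X M : Type u} [AddCommGroup M] [Module R M]

/-- Monomials are written through an arbitrary listing `toList` of a multiset; this makes the choice
of listing harmless. -/
theorem tprod_congr_of_map_univ_eq {f g : Fin n → M}
    (h : Finset.univ.val.map f = Finset.univ.val.map g) :
    SymmetricPower.tprod R f = SymmetricPower.tprod R g := by
  obtain ⟨e, he⟩ := exists_perm_of_map_univ_eq h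
  rw [← SymmetricPower.tprod_equiv e g]
  exact congrArg _ (funext fun a => (he a).symm)

theorem map_univ_toList_get {X : Type*} (s : Multiset X) (h : s.card = n) :
    Finset.univ.val.map (fun a : Fin n =>
      s.toList.get (Fin.cast (by rw [Multiset.length_toList, h]) a)) = s := by
  subst h
  conv_rhs => rw [← s.coe_toList, ← List.ofFn_get s.toList]
  rw [Fin.univ_val_map, Multiset.coe_eq_coe]
  refine List.Perm.of_eq ?_
  refine List.ext_get (by simp) fun i h₁ h₂ => by simp

/-- The linear map from polynomials to the symmetric power sending a monomial `X_{a₁} ⋯ X_{aₙ}`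
to `x_{a₁} ⋯ x_{aₙ}`, and monomials of degree different from `n` to zero. -/
noncomputable def ofPoly {X : Type*} (n : ℕ) (x : X → M) :
    MvPolynomial X R →ₗ[R] Sym[R] (Fin n) M :=
  (MvPolynomial.basisMonomials X R).constr R fun s =>
    if h : s.toMultiset.card = n then
      SymmetricPower.tprod R fun a : Fin n =>
        x (s.toMultiset.toList.get (Fin.cast (by rw [Multiset.length_toList, h]) a))
    else 0

theorem ofPoly_prod {X : Type*} (x : X → M) (f : Fin n → X) :
    ofPoly n x (∏ a, (MvPolynomial.X (f a) : MvPolynomial X R)) =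
      SymmetricPower.tprod R fun a => x (f a) := by
  classical
  have h : (∏ a, (MvPolynomial.X (f a) : MvPolynomial X R)) =
      MvPolynomial.basisMonomials X R (∑ a, Finsupp.single (f a) 1) := by
    rw [MvPolynomial.coe_basisMonomials]
    exact (MvPolynomial.monomial_sum_one Finset.univ fun a => Finsupp.single (f a) 1).symm
  have hs : (∑ a, Finsupp.single (f a) 1 : X →₀ ℕ).toMultiset = Finset.univ.val.map f := by
    rw [map_sum]
    simp only [Finsupp.toMultiset_single, one_nsmul]
    refine Eq.trans ?_ (Multiset.sum_map_singleton _)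
    rw [Multiset.map_map]
    rfl
  have hc : (∑ a, Finsupp.single (f a) 1 : X →₀ ℕ).toMultiset.card = n := by rw [hs]; simp
  rw [h, ofPoly, Module.Basis.constr_basis, dif_pos hc]
  apply tprod_congr_of_map_univ_eq
  refine (Multiset.map_map x _ _).symm.trans (Eq.trans ?_ (Multiset.map_map x f _))
  rw [map_univ_toList_get _ hc, hs]

/-- The linear map from the symmetric power of a free module to polynomials. -/
noncomputable def toPoly (R : Type) [CommRing R] (n : ℕ) (X : Type u) :
    Sym[R] (Fin n) (X →₀ R) →ₗ[R] MvPolynomial X R :=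
  symLift ((MultilinearMap.mkPiAlgebra R (Fin n) (MvPolynomial X R)).compLinearMap
      fun _ => Finsupp.linearCombination R MvPolynomial.X) fun e v => by
        simp [Equiv.prod_comp e fun a => Finsupp.linearCombination R
          (MvPolynomial.X : X → MvPolynomial X R) (v a)]

theorem toPoly_tprod (v : Fin n → X →₀ R) :
    toPoly R n X (SymmetricPower.tprod R v) =
      ∏ a, Finsupp.linearCombination R (MvPolynomial.X : X → MvPolynomial X R) (v a) :=
  symLift_tprod (M := X →₀ R) (N := MvPolynomial X R) _ _ _

/-- A multilinear map on a free module is determined by basis vectors, where both sides are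
monomials. The resulting injectivity of `toPoly` is the source of torsion-freeness. -/
theorem ofPoly_comp_toPoly (R : Type) [CommRing R] (n : ℕ) (X : Type u) :
    ofPoly n (fun a : X => Finsupp.single a (1 : R)) ∘ₗ toPoly R n X = LinearMap.id := by
  refine LinearMap.ext_on_range (SymmetricPower.span_tprod_eq_top R (Fin n) (X →₀ R))
    fun v => ?_
  have h : (ofPoly n (fun a : X => Finsupp.single a (1 : R)) ∘ₗ toPoly R n X).compMultilinearMap
      (SymmetricPower.tprod R : MultilinearMap R (fun _ : Fin n => X →₀ R) _) =
        SymmetricPower.tprod R := by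
    refine Module.Basis.ext_multilinear (ιM := fun _ => X) (fun _ => Finsupp.basisSingleOne) fun w => ?_
    simp only [LinearMap.compMultilinearMap_apply, LinearMap.comp_apply,
      Finsupp.coe_basisSingleOne, toPoly_tprod, Finsupp.linearCombination_single, one_smul,
      ofPoly_prod]
  exact DFunLike.congr_fun h v

theorem toPoly_injective (R : Type) [CommRing R] (n : ℕ) (X : Type u) :
    Function.Injective (toPoly R n X) :=
  Function.LeftInverse.injective (g := ofPoly n fun a : X => Finsupp.single a (1 : R))
    fun a => congrArg (fun f => f a) (ofPoly_comp_toPoly R n X)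

theorem smul_right_injective_symPower [IsDomain R] {c : R} (hc : c ≠ 0) :
    Function.Injective fun a : Sym[R] (Fin n) (X →₀ R) => c • a := by
  intro a b h
  apply toPoly_injective
  have h := congrArg (toPoly R n X) h
  simp only [map_smul] at h
  exact smul_right_injective _ hc h

variable (R n) in
/-- The power `xⁿ` in the `n`-th symmetric power. -/
noncomputable def symPure (x : M) : Sym[R] (Fin n) M := SymmetricPower.tprod R fun _ => x

theorem symMap_symPure {N : Type u} [AddCommGroup N] [Module R N] (f : M →ₗ[R] N) (x : M) :
    symMap f (symPure R n x) = symPure R n (f x) := symMap_tprod _ _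

/-- Carries the multinomial theorem from polynomials to `Symⁿ M`, which has no ring structure of its
own here. -/
theorem ofPoly_sum_pow {k : ℕ} (x : Fin k → M) :
    ofPoly n x ((∑ l, MvPolynomial.X l : MvPolynomial (Fin k) R) ^ n) =
      symPure R n (∑ l, x l) := by
  rw [Finset.sum_pow', map_sum, symPure, MultilinearMap.map_sum, Fintype.piFinset_univ]
  exact Finset.sum_congr rfl fun f _ => ofPoly_prod x f

end Polynomial

/-! ### The operations `σ` and `μ` -/

section Sigma

variable {p : ℕ} {M N : Type u} [AddCommGroup M] [Module (ZInv p) M]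
  [AddCommGroup N] [Module (ZInv p) N]

theorem ofPoly_multiset_prod {k : ℕ} (x : Fin k → M) (s : Sym (Fin k) p) :
    ofPoly p x ((s.1.map MvPolynomial.X).prod : MvPolynomial (Fin k) (ZInv p)) =
      symMonomial p x s := by
  conv_lhs => rw [← map_univ_toList_get s.1 s.2, Multiset.map_map]
  exact ofPoly_prod x _

theorem symPure_sum {k : ℕ} (x : Fin k → M) :
    symPure (ZInv p) p (∑ l, x l) =
      ∑ s : Sym (Fin k) p, s.1.countPerms • symMonomial p x s := by
  rw [← ofPoly_sum_pow, Finset.sum_pow, Finset.sym_univ, map_sum]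
  refine Finset.sum_congr rfl fun s _ => ?_
  rw [← nsmul_eq_mul, map_nsmul]
  exact congrArg _ (ofPoly_multiset_prod x s)

theorem prod_factorial_mul_countPerms {k : ℕ} (s : Sym (Fin k) p) :
    (∏ l, (s.1.count l)!) * s.1.countPerms = p ! := by
  rw [Multiset.countPerms, Finsupp.multinomial_eq_of_support_subset (Finset.subset_univ _)]
  have := Nat.multinomial_spec Finset.univ (s.1.toFinsupp : Fin k → ℕ)
  simp only [Multiset.toFinsupp_apply] at this
  rw [this, Multiset.sum_count_eq_card (fun _ _ => Finset.mem_univ _), s.2]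

theorem isUnit_factorial {a : ℕ} (ha : a ≤ p - 1) : IsUnit ((a ! : ℕ) : ZInv p) := by
  have h : IsUnit (((p - 1)! : ℕ) : ZInv p) := by
    simpa using IsLocalization.Away.algebraMap_isUnit (S := ZInv p) (((p - 1)! : ℕ) : ℤ)
  exact isUnit_of_dvd_unit (Nat.cast_dvd_cast (Nat.factorial_dvd_factorial ha)) h

/-- The multinomial coefficient is `p!/∏ j_l!`, so `p! σ_p` is the multinomial expansion with the
pure `p`-th powers left out. -/
theorem factorial_smul_sigma (hp : 0 < p) {k : ℕ} (x : Fin k → M) :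
    (p ! : ZInv p) • sigma p x =
      symPure (ZInv p) p (∑ l, x l) - ∑ l, symPure (ZInv p) p (x l) := by
  rw [symPure_sum, eq_sub_iff_add_eq, ← Finset.sum_filter_add_sum_filter_not Finset.univ
    (fun s : Sym (Fin k) p => ∀ l, s.1.count l ≤ p - 1), sigma, Finset.smul_sum]
  congr 1
  · refine Finset.sum_congr rfl fun s hs => ?_
    have hs := (Finset.mem_filter.1 hs).2
    rw [smul_smul, ← prod_factorial_mul_countPerms s, Nat.cast_mul, Nat.cast_prod,
      mul_right_comm, ← Finset.prod_mul_distrib, Finset.prod_eq_one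
        fun l _ => Ring.mul_inverse_cancel _ (isUnit_factorial (hs l)), one_mul, Nat.cast_smul_eq_nsmul]
  -- A multiset of size `p` in which some `l` occurs `p` times is constant, so the monomials
  -- excluded from `σ_p` are exactly the powers `x_lᵖ`, each with coefficient one.
  · have hc : ∀ s : Sym (Fin k) p, ∀ l, p ≤ s.1.count l → s = Sym.replicate p l :=
      fun s l h => Subtype.ext (Multiset.eq_replicate.2 ⟨s.2, fun b hb =>
        ((Multiset.count_eq_card.1 (le_antisymm (Multiset.count_le_card _ _)
          (s.2.trans_le h)) : ∀ b ∈ s.1, l = b) b hb).symm⟩)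
    refine Finset.sum_nbij (fun l => Sym.replicate p l) ?_ ?_ ?_ ?_
    · intro l _
      simp only [Finset.mem_filter, Finset.mem_univ, true_and, not_forall]
      exact ⟨l, by simp [Sym.replicate]; omega⟩
    · intro l _ l' _ h
      exact (Sym.replicate_right_inj hp.ne').1 h
    · intro s hs
      simp only [Finset.coe_filter, Finset.mem_univ, true_and, not_forall, Set.mem_ofPred_eq] at hs
      obtain ⟨l, hl⟩ := hs
      exact ⟨l, by simp, (hc s l (by omega)).symm⟩
    · intro l _
      have h1 := prod_factorial_mul_countPerms (Sym.replicate p l)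
      have h2 : ∏ l', ((Sym.replicate p l).1.count l')! = p ! := by
        rw [Finset.prod_eq_single l]
        · simp [Sym.replicate]
        · intro b _ hb
          simp [Sym.replicate, Multiset.count_replicate, hb.symm]
        · simp
      rw [h2] at h1
      rw [Nat.eq_of_mul_eq_mul_left (Nat.factorial_pos p) (h1.trans (mul_one _).symm), one_smul]
      refine congrArg _ (funext fun a => ?_)
      exact congrArg x (Multiset.eq_of_mem_replicate (n := p)
        (Multiset.mem_toList.1 (List.get_mem _ _))).symm

theorem factorial_smul_sigma_pair (hp : 0 < p) (x y : M) :
    (p ! : ZInv p) • sigma p ![x, y] = symPure (ZInv p) p (x + y) -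
      (symPure (ZInv p) p x + symPure (ZInv p) p y) := by
  rw [factorial_smul_sigma hp, Fin.sum_univ_two, Fin.sum_univ_two]
  rfl

theorem symMap_sigma {k : ℕ} (f : M →ₗ[ZInv p] N) (x : Fin k → M) :
    symMap f (sigma p x) = sigma p fun l => f (x l) := by
  rw [sigma, sigma, map_sum]
  refine Finset.sum_congr rfl fun s _ => ?_
  rw [map_smul, symMonomial, symMap_tprod]
  rfl

theorem symMap_mu {k : ℕ} (f : M →ₗ[ZInv p] N) (y : Fin k → M) :
    symMap f (mu p y) = mu p fun l => f (y l) := by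
  rw [mu, mu, map_sub, map_sum, symMap_sigma]
  congr 1
  · simp only [map_zsmul]
  · refine Finset.sum_congr rfl fun l _ => ?_
    rw [symMap_sigma]
    congr 1
    ext a
    fin_cases a <;> simp

instance : IsDomain (ZInv p) :=
  IsLocalization.isDomain_localization (powers_le_nonZeroDivisors_of_noZeroDivisors
    (Int.natCast_ne_zero.2 (Nat.factorial_ne_zero _)))

theorem factorial_ne_zero : (p ! : ZInv p) ≠ 0 := by
  have h : Function.Injective (algebraMap ℤ (ZInv p)) :=
    IsLocalization.injective _ (powers_le_nonZeroDivisors_of_noZeroDivisors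
      (Int.natCast_ne_zero.2 (Nat.factorial_ne_zero (p - 1))))
  have := h.ne (Int.natCast_ne_zero.2 (Nat.factorial_ne_zero p))
  simpa using this

theorem symPure_zero (hp : 0 < p) : symPure (ZInv p) p (0 : M) = 0 :=
  MultilinearMap.map_coord_zero _ ⟨0, hp⟩ rfl

/-- Because `p! σ_p(y, -y) = -(yᵖ + (-y)ᵖ)`, the correction terms in `μ_p` replace each `(-y_l)ᵖ` by
`-y_lᵖ`. The signs are then those of an alternating sum for every `p`, including `p = 2`. -/
theorem factorial_smul_mu (hp : 0 < p) {k : ℕ} (y : Fin k → M) :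
    (p ! : ZInv p) • mu p y = symPure (ZInv p) p (∑ l : Fin k, (-1 : ℤ) ^ (l : ℕ) • y l) -
      ∑ l : Fin k, (-1 : ℤ) ^ (l : ℕ) • symPure (ZInv p) p (y l) := by
  rw [mu, smul_sub, factorial_smul_sigma hp, Finset.smul_sum]
  refine (sub_sub (α := Sym[ZInv p] (Fin p) M) _ _ _).trans (congrArg _ ?_)
  rw [Finset.sum_filter, ← Finset.sum_add_distrib]
  refine Finset.sum_congr rfl fun l _ => ?_
  split_ifs with h
  · rw [factorial_smul_sigma hp, h.neg_one_pow]
    simp only [Fin.sum_univ_two, Matrix.cons_val_zero, Matrix.cons_val_one, add_neg_cancel,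
      symPure_zero hp, neg_smul, one_smul]
    abel
  · rw [(Nat.not_odd_iff_even.1 h).neg_one_pow]
    simp

theorem symMap_zero (hp : 0 < p) (a : Sym[ZInv p] (Fin p) M) :
    symMap (0 : M →ₗ[ZInv p] N) a = 0 := by
  have h : symMap (ι := Fin p) (0 : M →ₗ[ZInv p] N) = 0 :=
    LinearMap.ext_on_range (SymmetricPower.span_tprod_eq_top (ZInv p) (Fin p) M) fun v =>
      (symMap_tprod _ v).trans (symPure_zero hp)
  rw [h, LinearMap.zero_apply]

theorem mu_zero (hp : 0 < p) {k : ℕ} : mu p (fun _ : Fin k => (0 : M)) = 0 :=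
  (symMap_mu (0 : M →ₗ[ZInv p] M) fun _ => 0).symm.trans (symMap_zero hp _)

theorem sigma_zero_right_of_injective (hp : 0 < p)
    (hM : Function.Injective fun a : Sym[ZInv p] (Fin p) M => (p ! : ZInv p) • a) (x : M) :
    sigma p ![x, 0] = 0 := by
  apply hM
  change (p ! : ZInv p) • _ = (p ! : ZInv p) • _
  rw [factorial_smul_sigma_pair hp, symPure_zero hp, add_zero, add_zero, sub_self, smul_zero]

/-- After multiplication by `p!` the sum telescopes: both sides become the `p`-th power of the total
minus the sum of the `p`-th powers. -/
theorem sigma_snoc_of_injective (hp : 0 < p)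
    (hM : Function.Injective fun a : Sym[ZInv p] (Fin p) M => (p ! : ZInv p) • a) {k : ℕ}
    (x : Fin (k + 1) → M) :
    sigma p x = sigma p (fun l : Fin k => x l.castSucc) +
      sigma p ![∑ l : Fin k, x l.castSucc, x (Fin.last k)] := by
  apply hM
  change (p ! : ZInv p) • _ = (p ! : ZInv p) • _
  rw [smul_add, factorial_smul_sigma hp, factorial_smul_sigma hp, factorial_smul_sigma_pair hp,
    Fin.sum_univ_castSucc x, Fin.sum_univ_castSucc fun l => symPure (ZInv p) p (x l)]
  abel

variable (p M) in
theorem injective_factorial_smul_free : Function.Injective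
    fun a : Sym[ZInv p] (Fin p) (M →₀ ZInv p) => (p ! : ZInv p) • a :=
  smul_right_injective_symPower factorial_ne_zero

theorem sigma_zero_right (hp : 0 < p) (x : M) : sigma p ![x, 0] = 0 := by
  have h := sigma_zero_right_of_injective hp (injective_factorial_smul_free p M)
    (Finsupp.single x (1 : ZInv p))
  have h' := congrArg (symMap (Finsupp.linearCombination (ZInv p) id)) h
  rw [symMap_sigma, map_zero] at h'
  rw [← h']
  congr 1
  ext l
  fin_cases l <;> simp

/-- Adding a variable to `σ_p`. -/
theorem sigma_snoc (hp : 0 < p) {k : ℕ} (x : Fin (k + 1) → M) :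
    sigma p x = sigma p (fun l : Fin k => x l.castSucc) +
      sigma p ![∑ l : Fin k, x l.castSucc, x (Fin.last k)] := by
  -- The identity is lifted to the free module on the set `M`, where `p!` can be cancelled, and
  -- pushed back along the evaluation map.
  let y : Fin (k + 1) → M →₀ ZInv p := fun l => Finsupp.single (x l) 1
  have hy : ∀ l, Finsupp.linearCombination (ZInv p) id (y l) = x l := fun l => by simp [y]
  have h' := congrArg (symMap (Finsupp.linearCombination (ZInv p) id))
    (sigma_snoc_of_injective hp (injective_factorial_smul_free p M) y)
  rw [map_add, symMap_sigma, symMap_sigma, symMap_sigma] at h'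
  simp only [hy] at h'
  rw [h']
  congr 2
  ext l
  fin_cases l <;> simp [hy]

end Sigma

end TruncExp

namespace TruncExp

/-! ### The operation `φ` on cochains -/

section Phi

variable {p : ℕ} {P Q : CosimplicialObject (ModuleCat.{u} (ZInv p))}

/-- The `p`-th power of a cochain. -/
noncomputable def cochainPow (P : CosimplicialObject (ModuleCat.{u} (ZInv p))) {i : ℕ}
    (x : (toAb P).obj (.mk i)) : (toAb (symPow p P)).obj (.mk i) :=
  symPure (ZInv p) p (M := P.obj (.mk i)) x

/-- The operation `σ_p(x, y)` on cochains. -/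
noncomputable def cochainSigma (P : CosimplicialObject (ModuleCat.{u} (ZInv p))) {i : ℕ}
    (x y : (toAb P).obj (.mk i)) : (toAb (symPow p P)).obj (.mk i) :=
  sigma p (M := P.obj (.mk i)) ![x, y]

theorem cobd_cochainPow {i : ℕ} (x : (toAb P).obj (.mk i)) :
    cobd (toAb (symPow p P)) i (cochainPow P x) =
      ∑ k : Fin (i + 2), (-1 : ℤ) ^ (k : ℕ) • cochainPow P (((toAb P).δ k).hom x) := by
  rw [cobd_eq_sum]
  exact Finset.sum_congr rfl fun k _ => congrArg _
    (symMap_symPure (P.δ k).hom (x : P.obj (.mk i)))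

/-- Up to the factor `p!`, `φ` measures how far the `p`-th power is from commuting with `d`. Cofaces
commute with `p`-th powers, so only the additivity of `d` is at stake. -/
theorem factorial_smul_phi (hp : 0 < p) {i : ℕ} (x : (toAb P).obj (.mk i)) :
    p ! • phi p P i x =
      cochainPow P (cobd (toAb P) i x) - cobd (toAb (symPow p P)) i (cochainPow P x) := by
  have h := factorial_smul_mu hp (M := P.obj (.mk (i + 1))) fun k : Fin (i + 2) => (P.δ k).hom x
  rw [Nat.cast_smul_eq_nsmul] at h
  rw [cobd_cochainPow, cobd_eq_sum]
  exact h

theorem factorial_smul_cochainSigma (hp : 0 < p) {i : ℕ} (x y : (toAb P).obj (.mk i)) :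
    p ! • cochainSigma P x y = cochainPow P (x + y) - (cochainPow P x + cochainPow P y) := by
  have h := factorial_smul_sigma hp (M := P.obj (.mk i)) ![x, y]
  rw [Fin.sum_univ_two, Fin.sum_univ_two, Nat.cast_smul_eq_nsmul] at h
  exact h

/-- Multiplied by `p!`, both sides equal `d((dx)ᵖ)`, because `d² = 0` and `0ᵖ = 0`. -/
theorem cobd_phi_of_injective (hp : 0 < p) (hP : ∀ n, Function.Injective
    fun a : (toAb (symPow p P)).obj (.mk n) => p ! • a) {i : ℕ} (x : (toAb P).obj (.mk i)) :
    cobd (toAb (symPow p P)) (i + 1) (phi p P i x) = -phi p P (i + 1) (cobd (toAb P) i x) := by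
  apply hP
  have h0 : cochainPow P (0 : (toAb P).obj (.mk (i + 1 + 1))) = 0 :=
    symPure_zero hp (M := P.obj (.mk (i + 1 + 1)))
  change p ! • _ = p ! • _
  rw [smul_neg, factorial_smul_phi hp, ← map_nsmul, factorial_smul_phi hp, cobd_cobd, map_sub,
    cobd_cobd, h0]
  abel

/-- Multiplied by `p!`, the change in `φ` is `-d((y + dw)ᵖ - yᵖ)`. The bracket is `p! σ_p(y, dw) +
(dw)ᵖ`, and `(dw)ᵖ` is `p! φ(w)` up to the coboundary `d(wᵖ)`. -/
theorem phi_add_cobd_of_injective (hp : 0 < p) (hP : ∀ n, Function.Injective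
    fun a : (toAb (symPow p P)).obj (.mk n) => p ! • a) {i : ℕ} (y : (toAb P).obj (.mk (i + 1)))
    (w : (toAb P).obj (.mk i)) :
    phi p P (i + 1) (y + cobd (toAb P) i w) = phi p P (i + 1) y -
      cobd (toAb (symPow p P)) (i + 1) (cochainSigma P y (cobd (toAb P) i w) + phi p P i w) := by
  apply hP
  change p ! • _ = p ! • _
  rw [smul_sub, ← map_nsmul, smul_add, factorial_smul_phi hp, factorial_smul_phi hp,
    factorial_smul_phi hp, factorial_smul_cochainSigma hp, map_add (cobd (toAb P) (i + 1)),
    cobd_cobd, map_add, map_sub, map_sub, map_add, cobd_cobd, add_zero]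
  abel

/-- The map of cosimplicial modules `Symᵖ P → Symᵖ Q` induced by `P → Q`. -/
noncomputable abbrev symPowMap (g : P ⟶ Q) : symPow p P ⟶ symPow p Q :=
  ((CosimplicialObject.whiskering _ _).obj (symFunctor p)).map g

theorem symPowMap_phi (g : P ⟶ Q) {i : ℕ} (x : (toAb P).obj (.mk i)) :
    ((toAbMap (symPowMap g)).app (.mk (i + 1))).hom (phi p P i x) =
      phi p Q i (((toAbMap g).app (.mk i)).hom x) := by
  refine (symMap_mu (g.app (.mk (i + 1))).hom _).trans (congrArg _ (funext fun k => ?_))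
  exact congrArg (fun f => f.hom x) (g.naturality (SimplexCategory.δ k))

theorem symPowMap_cochainSigma (g : P ⟶ Q) {i : ℕ} (x y : (toAb P).obj (.mk i)) :
    ((toAbMap (symPowMap g)).app (.mk i)).hom (cochainSigma P x y) =
      cochainSigma Q (((toAbMap g).app (.mk i)).hom x) (((toAbMap g).app (.mk i)).hom y) := by
  refine (symMap_sigma (g.app (.mk i)).hom _).trans (congrArg _ (funext fun k => ?_))
  fin_cases k <;> rfl

/-- The functor sending a module to the free module on its underlying set. -/
noncomputable def freeCover (R : Type) [CommRing R] : ModuleCat.{u} R ⥤ ModuleCat.{u} R where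
  obj M := ModuleCat.of R (M →₀ R)
  map f := ModuleCat.ofHom (Finsupp.lmapDomain R R f.hom)
  map_id M := by ext1; exact Finsupp.lmapDomain_id R R
  map_comp f g := by
    ext1
    exact Finsupp.lmapDomain_comp R R (fun x => f.hom x) (fun x => g.hom x)

/-- The canonical map from the free module on the underlying set of a module. -/
noncomputable def freeCoverMap (R : Type) [CommRing R] : freeCover.{u} R ⟶ 𝟭 _ where
  app M := ModuleCat.ofHom (Finsupp.linearCombination R id)
  naturality M N f := by
    ext1
    refine Finsupp.lhom_ext fun a b => ?_
    simp [freeCover]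

variable (P) in
/-- A cosimplicial module with free terms mapping onto `P`. -/
noncomputable abbrev cover : CosimplicialObject (ModuleCat.{u} (ZInv p)) :=
  ((CosimplicialObject.whiskering _ _).obj (freeCover (ZInv p))).obj P

variable (P) in
/-- The canonical map `cover P ⟶ P`. -/
noncomputable def coverMap : cover P ⟶ P where
  app n := (freeCoverMap (ZInv p)).app (P.obj n)
  naturality _ _ f := (freeCoverMap (ZInv p)).naturality (P.map f)

theorem coverMap_surjective (n : SimplexCategory) :
    Function.Surjective ((toAbMap (coverMap P)).app n).hom := by
  have h : ∀ x : P.obj n, Finsupp.linearCombination (ZInv p) id (Finsupp.single x 1) = x :=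
    fun x => by simp
  exact fun x => ⟨_, h x⟩

theorem injective_factorial_smul_cover (n : ℕ) : Function.Injective
    fun a : (toAb (symPow p (cover P))).obj (.mk n) => p ! • a := by
  have h := injective_factorial_smul_free p (P.obj (.mk n))
  simp only [Nat.cast_smul_eq_nsmul] at h
  exact h

/-- A lift of a cocycle to the free cover need not be a cocycle. The identity is therefore proved
for all cochains, so that it can be checked on any lift. -/
theorem cobd_phi (hp : 0 < p) {i : ℕ} (x : (toAb P).obj (.mk i)) :
    cobd (toAb (symPow p P)) (i + 1) (phi p P i x) = -phi p P (i + 1) (cobd (toAb P) i x) := by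
  obtain ⟨x, rfl⟩ := coverMap_surjective _ x
  have h := congrArg ((toAbMap (symPowMap (coverMap P))).app (.mk (i + 1 + 1))).hom
    (cobd_phi_of_injective hp injective_factorial_smul_cover x)
  rw [map_neg, ← cobd_naturality, symPowMap_phi, symPowMap_phi, ← cobd_naturality] at h
  exact h

theorem phi_add_cobd (hp : 0 < p) {i : ℕ} (y : (toAb P).obj (.mk (i + 1)))
    (w : (toAb P).obj (.mk i)) :
    phi p P (i + 1) (y + cobd (toAb P) i w) = phi p P (i + 1) y -
      cobd (toAb (symPow p P)) (i + 1) (cochainSigma P y (cobd (toAb P) i w) + phi p P i w) := by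
  obtain ⟨y, rfl⟩ := coverMap_surjective _ y
  obtain ⟨w, rfl⟩ := coverMap_surjective _ w
  have h := congrArg ((toAbMap (symPowMap (coverMap P))).app (.mk (i + 1 + 1))).hom
    (phi_add_cobd_of_injective hp injective_factorial_smul_cover y w)
  rw [map_sub, ← cobd_naturality, map_add, symPowMap_phi, symPowMap_phi, symPowMap_phi,
    symPowMap_cochainSigma, map_add, ← cobd_naturality] at h
  exact h

theorem phi_zero (hp : 0 < p) (P : CosimplicialObject (ModuleCat.{u} (ZInv p))) (i : ℕ) :
    phi p P i 0 = 0 := by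
  have h : (fun k : Fin (i + 2) => (P.δ k).hom (0 : P.obj (.mk i))) = fun _ => 0 :=
    funext fun k => map_zero (P.δ k).hom
  exact (congrArg (mu p) h).trans (mu_zero hp)

theorem phi_mem_cocycles (hp : 0 < p) (i : ℕ) (x) (hx : x ∈ cocycles (toAb P) i) :
    phi p P i x ∈ cocycles (toAb (symPow p P)) (i + 1) := by
  change cobd _ _ _ = 0
  rw [cobd_phi hp, show cobd (toAb P) i x = 0 from hx, phi_zero hp, neg_zero]

theorem phi_sub_phi_mem_coboundaries (hp : 0 < p) (i : ℕ) (x y)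
    (hxy : x - y ∈ coboundaries (toAb P) i) :
    phi p P i x - phi p P i y ∈ coboundaries (toAb (symPow p P)) (i + 1) := by
  cases i with
  | zero =>
    rw [sub_eq_zero.1 (show x - y = 0 from hxy), sub_self]
    exact zero_mem _
  | succ i =>
    obtain ⟨w, hw⟩ := hxy
    obtain rfl : x = y + cobd (toAb P) i w := by rw [hw, add_sub_cancel]
    rw [phi_add_cobd hp, sub_sub_cancel_left]
    exact neg_mem (AddMonoidHom.mem_range.2 ⟨_, rfl⟩)

end Phi

end TruncExp

namespace TruncExp

/-! ### Comparison of spectral sequences along a nonadditive bijection -/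

namespace FilteredCosimplicial

variable {K : FilteredCosimplicial.{u}}

theorem cobd_mem {j : ℤ} {i : ℕ} {x : K.X.obj (.mk i)} (hx : x ∈ K.F j (.mk i)) :
    cobd K.X i x ∈ K.F j (.mk (i + 1)) := by
  rw [cobd_eq_sum]
  exact sum_mem fun k _ => zsmul_mem (K.map_mem j (SimplexCategory.δ k) x hx) _

theorem mkE_eq_iff {r j : ℤ} {i : ℕ} {x y : K.Z r i j} :
    K.mkE r i j x = K.mkE r i j y ↔ x.1 - y.1 ∈ K.B r i j := by
  refine QuotientAddGroup.eq.trans ?_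
  rw [AddSubgroup.mem_addSubgroupOf, ← neg_mem_iff]
  simp [sub_eq_neg_add]

theorem mkE_surjective (r : ℤ) (i : ℕ) (j : ℤ) : Function.Surjective (K.mkE r i j) :=
  QuotientAddGroup.mk'_surjective _

theorem mem_B_of_mem_Z {r j : ℤ} {i : ℕ} {x : K.X.obj (.mk i)}
    (hx : x ∈ K.Z (r - 1) i (j + 1)) : x ∈ K.B r i j := by
  cases i with
  | zero => exact hx
  | succ i => exact AddSubgroup.mem_sup_left hx

theorem mem_Z_of_mem {r j j' : ℤ} {i : ℕ} {x : K.X.obj (.mk i)} (hx : x ∈ K.F j' (.mk i))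
    (h : j ≤ j') (h' : j + r ≤ j') : x ∈ K.Z r i j :=
  ⟨K.antitone h _ hx, K.antitone h' _ (cobd_mem hx)⟩

theorem dE_mkE {r j j' : ℤ} {i : ℕ} (h : j + r = j') (x : K.Z r i j)
    (hx : cobd K.X i x.1 ∈ K.Z r (i + 1) j') :
    K.dE r i j j' h (K.mkE r i j x) = K.mkE r (i + 1) j' ⟨cobd K.X i x.1, hx⟩ := rfl

theorem cobd_mem_Z {r j j' : ℤ} {i : ℕ} (h : j + r = j') {x : K.X.obj (.mk i)}
    (hx : x ∈ K.Z r i j) : cobd K.X i x ∈ K.Z r (i + 1) j' := by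
  subst h
  refine ⟨hx.2, ?_⟩
  change cobd K.X (i + 1) (cobd K.X i x) ∈ K.F (j + r + r) (.mk (i + 1 + 1))
  rw [cobd_cobd]
  exact zero_mem _

/-- The boundaries for the page `r + 1` are those for the page `r` that survive. -/
theorem mem_B_succ {r j : ℤ} {i : ℕ} {x : K.X.obj (.mk i)} (hx : x ∈ K.B r i j)
    (hx' : x ∈ K.Z (r + 1) i j) : x ∈ K.B (r + 1) i j := by
  have hd : cobd K.X i x ∈ K.F (j + (r + 1)) (.mk (i + 1)) := hx'.2
  cases i with
  | zero =>
    refine mem_B_of_mem_Z ⟨hx.1, ?_⟩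
    change cobd K.X 0 x ∈ K.F (j + 1 + (r + 1 - 1)) (.mk (0 + 1))
    rwa [show j + 1 + (r + 1 - 1) = j + (r + 1) by ring]
  | succ i =>
    obtain ⟨y, hy, z, ⟨w, hw, rfl⟩, rfl⟩ := AddSubgroup.mem_sup.mp hx
    -- Since `d(dw) = 0`, the coboundary of `y` is that of `x`, so `y` inherits the extra step of
    -- filtration.
    rw [map_add, cobd_cobd, add_zero] at hd
    refine add_mem (mem_B_of_mem_Z ⟨hy.1, ?_⟩) (AddSubgroup.mem_sup_right ⟨w, ⟨?_, ?_⟩, rfl⟩)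
    · change cobd K.X (i + 1) y ∈ K.F (j + 1 + (r + 1 - 1)) (.mk (i + 1 + 1))
      rwa [show j + 1 + (r + 1 - 1) = j + (r + 1) by ring]
    · exact K.antitone (show j - (r + 1) + 1 ≤ j - r + 1 by omega) _ hw.1
    · exact K.antitone (show j - (r + 1) + 1 + (r + 1 - 1) ≤ j - r + 1 + (r - 1) by omega) _ hw.2

end FilteredCosimplicial

/-- A bijection between filtered cosimplicial abelian groups which respects the filtrations, and
respects addition and coboundaries up to terms of filtration higher by `q`. -/
structure Comparison (K L : FilteredCosimplicial.{u}) (q : ℤ) where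
  map : ∀ i : ℕ, K.X.obj (.mk i) → L.X.obj (.mk i)
  sumDefect : ∀ i : ℕ, K.X.obj (.mk i) → K.X.obj (.mk i) → K.X.obj (.mk i)
  cobdDefect : ∀ i : ℕ, K.X.obj (.mk i) → K.X.obj (.mk (i + 1))
  bijective : ∀ i, Function.Bijective (map i)
  map_zero : ∀ i, map i 0 = 0
  mem_iff : ∀ i j x, map i x ∈ L.F j (.mk i) ↔ x ∈ K.F j (.mk i)
  map_add : ∀ i x y, map i x + map i y = map i (x + y + sumDefect i x y)
  map_cobd : ∀ i x, cobd L.X i (map i x) = map (i + 1) (cobd K.X i x + cobdDefect i x)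
  sumDefect_mem : ∀ i j x y, y ∈ K.F j (.mk i) → sumDefect i x y ∈ K.F (j + q) (.mk i)
  cobdDefect_mem : ∀ i j x, x ∈ K.F j (.mk i) → cobdDefect i x ∈ K.F (j + q) (.mk (i + 1))

namespace Comparison

open FilteredCosimplicial

variable {K L : FilteredCosimplicial.{u}} {q : ℤ} (C : Comparison K L q)

/-- This is `d² = 0` in `L`, pulled back along the injective comparison map. It bounds the
filtration of the coboundary of the error. -/
theorem cobd_cobdDefect (i : ℕ) (x : K.X.obj (.mk i)) :
    cobd K.X (i + 1) (C.cobdDefect i x) =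
      -C.cobdDefect (i + 1) (cobd K.X i x + C.cobdDefect i x) := by
  have h := cobd_cobd L.X i (C.map i x)
  rw [C.map_cobd, C.map_cobd, ← C.map_zero] at h
  have h := (C.bijective _).1 h
  rwa [_root_.map_add, cobd_cobd, zero_add, add_eq_zero_iff_eq_neg] at h

theorem map_mem_Z_iff {r j : ℤ} {i : ℕ} {x : K.X.obj (.mk i)} (hr : r ≤ q) :
    C.map i x ∈ L.Z r i j ↔ x ∈ K.Z r i j := by
  have h : x ∈ K.F j (.mk i) → (cobd L.X i (C.map i x) ∈ L.F (j + r) (.mk (i + 1)) ↔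
      cobd K.X i x ∈ K.F (j + r) (.mk (i + 1))) := fun hx => by
    rw [C.map_cobd, C.mem_iff]
    exact add_mem_cancel_right (K.antitone (by omega) _ (C.cobdDefect_mem i j x hx))
  constructor
  · rintro ⟨h₁, h₂⟩
    have h₁ := (C.mem_iff i j x).1 h₁
    exact ⟨h₁, (h h₁).1 h₂⟩
  · rintro ⟨h₁, h₂⟩
    exact ⟨(C.mem_iff i j x).2 h₁, (h h₁).2 h₂⟩

/-- The error gains `q ≥ r` steps, hence lies in `F^{j+1}`. By `cobd_cobdDefect` its coboundary is
again an error, of an element of `F^j`, hence lies in `F^{j+q}`. -/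
theorem cobdDefect_mem_Z {r j : ℤ} {i : ℕ} {x : K.X.obj (.mk i)} (hr : r ≤ q)
    (hx : x ∈ K.Z (r - 1) i (j - r + 1)) : C.cobdDefect i x ∈ K.Z (r - 1) (i + 1) (j + 1) := by
  have h := C.cobdDefect_mem i _ x hx.1
  have hd : cobd K.X i x ∈ K.F j (.mk (i + 1)) :=
    K.antitone (show j ≤ j - r + 1 + (r - 1) by omega) _ hx.2
  refine ⟨K.antitone (by omega) _ h, ?_⟩
  change cobd K.X (i + 1) (C.cobdDefect i x) ∈ K.F (j + 1 + (r - 1)) (.mk (i + 1 + 1))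
  rw [C.cobd_cobdDefect]
  exact neg_mem (K.antitone (by omega) _
    (C.cobdDefect_mem (i + 1) j _ (add_mem hd (K.antitone (by omega) _ h))))

theorem map_mem_B_iff {r j : ℤ} {i : ℕ} {x : K.X.obj (.mk i)} (hq : 1 ≤ q) (hr : r ≤ q) :
    C.map i x ∈ L.B r i j ↔ x ∈ K.B r i j := by
  cases i with
  | zero => exact C.map_mem_Z_iff (by omega)
  | succ i =>
    -- The sum of `map u` and `d (map w)` is `map` of `u + dw` corrected by an element of the first
    -- summand of `B`. No condition on `u` is needed, since `sumDefect` is bounded through its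
    -- second argument alone.
    have key : ∀ w ∈ K.Z (r - 1) i (j - r + 1), ∀ u,
        u + (cobd K.X i w + C.cobdDefect i w) +
            C.sumDefect (i + 1) u (cobd K.X i w + C.cobdDefect i w) -
          (u + cobd K.X i w) ∈ K.Z (r - 1) (i + 1) (j + 1) := by
      intro w hw u
      have h := C.cobdDefect_mem_Z hr hw
      have hd : cobd K.X i w ∈ K.F j (.mk (i + 1)) :=
        K.antitone (show j ≤ j - r + 1 + (r - 1) by omega) _ hw.2
      have hs := C.sumDefect_mem (i + 1) j u (cobd K.X i w + C.cobdDefect i w)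
        (add_mem hd (K.antitone (by omega) _ h.1))
      have := add_mem h (mem_Z_of_mem (r := r - 1) (j := j + 1) hs (by omega) (by omega))
      convert this using 1
      abel
    constructor
    · intro h
      obtain ⟨y, hy, z, ⟨w, hw, rfl⟩, h⟩ := AddSubgroup.mem_sup.mp h
      obtain ⟨y, rfl⟩ := (C.bijective _).2 y
      obtain ⟨w, rfl⟩ := (C.bijective _).2 w
      have hy := (C.map_mem_Z_iff (by omega)).1 hy
      have hw := (C.map_mem_Z_iff (by omega)).1 hw
      rw [C.map_cobd, C.map_add] at h
      rw [← (C.bijective _).1 h]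
      have := key w hw y
      have := add_mem (mem_B_of_mem_Z (add_mem this hy))
        (AddSubgroup.mem_sup_right ⟨w, hw, rfl⟩ : cobd K.X i w ∈ K.B r (i + 1) j)
      convert this using 1
      abel
    · intro h
      obtain ⟨y, hy, z, ⟨w, hw, rfl⟩, rfl⟩ := AddSubgroup.mem_sup.mp h
      -- The image of `y + dw` is split as `map u + d (map w)`. The element `u` is only implicit,
      -- but `key` shows that it differs from `y` by an element of `Z_{r-1}^{j+1}`.
      obtain ⟨u, hu⟩ := (C.bijective (i + 1)).2
        (C.map (i + 1) (y + cobd K.X i w) - cobd L.X i (C.map i w))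
      have hu' := eq_sub_iff_add_eq.1 hu
      rw [C.map_cobd, C.map_add] at hu'
      have hu' := (C.bijective _).1 hu'
      have h := key w hw u
      rw [hu', add_sub_add_right_eq_sub] at h
      have hu'' : u ∈ K.Z (r - 1) (i + 1) (j + 1) := by
        rw [← sub_sub_cancel y u]
        exact sub_mem hy h
      rw [eq_sub_iff_add_eq.1 hu |>.symm]
      exact AddSubgroup.add_mem_sup ((C.map_mem_Z_iff (by omega)).2 hu'')
        ⟨_, (C.map_mem_Z_iff (by omega)).2 hw, rfl⟩

/-- Modulo boundaries, the comparison map is additive. -/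
theorem map_add_sub_mem_B {r j : ℤ} {i : ℕ} (hq : 1 ≤ q) (hr : r ≤ q) (x : K.X.obj (.mk i))
    {y : K.X.obj (.mk i)} (hx : x ∈ K.F j (.mk i)) (hy : y ∈ K.F j (.mk i)) :
    C.map i (x + y) - (C.map i x + C.map i y) ∈ L.B r i j := by
  -- The failure of additivity is `map u`, and `u` solves `u = sumDefect x y - sumDefect u (x + y)`.
  -- The occurrence of `u` on the right is harmless, because the bound uses only `x + y ∈ F^j`.
  obtain ⟨u, hu⟩ := (C.bijective i).2 (C.map i x + C.map i y - C.map i (x + y))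
  have hu' := eq_sub_iff_add_eq.1 hu
  rw [C.map_add, C.map_add] at hu'
  have hu' : u = C.sumDefect i x y - C.sumDefect i u (x + y) := by
    have := (C.bijective _).1 hu'
    rw [add_assoc, add_comm, add_assoc] at this
    rw [eq_sub_iff_add_eq, ← add_left_cancel this, add_comm]
  rw [← neg_sub, ← hu]
  refine neg_mem (mem_B_of_mem_Z ((C.map_mem_Z_iff (by omega)).2 ?_))
  refine mem_Z_of_mem (j' := j + q) ?_ (by omega) (by omega)
  rw [hu']
  exact sub_mem (C.sumDefect_mem i j _ _ hy) (C.sumDefect_mem i j _ _ (add_mem hx hy))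

/-- The map `Z_r(K) → E_r(L)` induced by the comparison map. -/
noncomputable def toPage (hq : 1 ≤ q) {r : ℤ} (hr : r ≤ q) (i : ℕ) (j : ℤ) :
    K.Z r i j →+ L.E r i j :=
  AddMonoidHom.mk' (fun x => L.mkE r i j ⟨C.map i x.1, (C.map_mem_Z_iff hr).2 x.2⟩) fun x y => by
    rw [← _root_.map_add, mkE_eq_iff]
    exact C.map_add_sub_mem_B hq hr x.1 x.2.1 y.2.1

/-- One direction makes the map of pages well defined, the other makes it injective. -/
theorem toPage_eq_zero_iff (hq : 1 ≤ q) {r : ℤ} (hr : r ≤ q) (i : ℕ) (j : ℤ) (x : K.Z r i j) :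
    C.toPage hq hr i j x = 0 ↔ x.1 ∈ K.B r i j := by
  rw [← C.map_mem_B_iff hq hr, ← _root_.map_zero (L.mkE r i j)]
  refine mkE_eq_iff.trans ?_
  rw [ZeroMemClass.coe_zero, sub_zero]

/-- The map of pages induced by a comparison map. -/
noncomputable def pageHom (hq : 1 ≤ q) {r : ℤ} (hr : r ≤ q) (i : ℕ) (j : ℤ) :
    K.E r i j →+ L.E r i j :=
  QuotientAddGroup.lift _ (C.toPage hq hr i j) fun x hx => (C.toPage_eq_zero_iff hq hr i j x).2 hx

theorem pageHom_bijective (hq : 1 ≤ q) {r : ℤ} (hr : r ≤ q) (i : ℕ) (j : ℤ) :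
    Function.Bijective (C.pageHom hq hr i j) := by
  constructor
  · rw [injective_iff_map_eq_zero]
    intro e he
    obtain ⟨x, rfl⟩ := mkE_surjective r i j e
    exact (QuotientAddGroup.eq_zero_iff x).2 ((C.toPage_eq_zero_iff hq hr i j x).1 he)
  · intro e
    obtain ⟨⟨y, hy⟩, rfl⟩ := mkE_surjective r i j e
    obtain ⟨x, rfl⟩ := (C.bijective i).2 y
    exact ⟨K.mkE r i j ⟨x, (C.map_mem_Z_iff hr).1 hy⟩, rfl⟩

/-- The isomorphism of pages induced by a comparison map. -/
noncomputable def pageEquiv (hq : 1 ≤ q) {r : ℤ} (hr : r ≤ q) (i : ℕ) (j : ℤ) :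
    K.E r i j ≃+ L.E r i j :=
  AddEquiv.ofBijective (C.pageHom hq hr i j) (C.pageHom_bijective hq hr i j)

theorem pageEquiv_mkE (hq : 1 ≤ q) {r : ℤ} (hr : r ≤ q) (i : ℕ) (j : ℤ) (x : K.Z r i j) :
    C.pageEquiv hq hr i j (K.mkE r i j x) =
      L.mkE r i j ⟨C.map i x.1, (C.map_mem_Z_iff hr).2 x.2⟩ := rfl

theorem pageEquiv_mkE_eq_iff (hq : 1 ≤ q) {r : ℤ} (hr : r ≤ q) (i : ℕ) (j : ℤ) (x : K.Z r i j)
    (y : L.Z r i j) :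
    C.pageEquiv hq hr i j (K.mkE r i j x) = L.mkE r i j y ↔ C.map i x.1 - y.1 ∈ L.B r i j := by
  rw [pageEquiv_mkE, mkE_eq_iff]

theorem cobd_add_cobdDefect_mem_Z {r j j' : ℤ} (hr : r ≤ q) {i : ℕ} (hj : j + r = j')
    {x : K.X.obj (.mk i)} (hx : x ∈ K.Z r i j) :
    cobd K.X i x + C.cobdDefect i x ∈ K.Z r (i + 1) j' := by
  rw [← C.map_mem_Z_iff hr, ← C.map_cobd]
  exact cobd_mem_Z hj ((C.map_mem_Z_iff hr).2 hx)

/-- The case `r = q` is allowed: there the error need not be a boundary, and it becomes the extra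
term in the differential. -/
theorem dE_pageEquiv (hq : 1 ≤ q) {r j j' : ℤ} (hr : r ≤ q) (i : ℕ) (hj : j + r = j')
    (x : K.Z r i j) :
    L.dE r i j j' hj (C.pageEquiv hq hr i j (K.mkE r i j x)) =
      C.pageEquiv hq hr (i + 1) j' (K.mkE r (i + 1) j'
        ⟨cobd K.X i x.1 + C.cobdDefect i x.1, C.cobd_add_cobdDefect_mem_Z hr hj x.2⟩) := by
  rw [pageEquiv_mkE, pageEquiv_mkE, dE_mkE hj _ (cobd_mem_Z hj ((C.map_mem_Z_iff hr).2 x.2))]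
  congr 2
  exact C.map_cobd i x.1

/-- For `r < q` the error lies in `F^{j'+1}` with coboundary deep enough to place it in
`Z_{r-1}^{j'+1}`, hence among the boundaries. -/
theorem pageEquiv_dE (hq : 1 ≤ q) {r j j' : ℤ} (hr : r < q) (i : ℕ) (hj : j + r = j')
    (e : K.E r i j) :
    C.pageEquiv hq hr.le (i + 1) j' (K.dE r i j j' hj e) =
      L.dE r i j j' hj (C.pageEquiv hq hr.le i j e) := by
  obtain ⟨x, rfl⟩ := mkE_surjective r i j e
  rw [dE_pageEquiv, dE_mkE hj _ (cobd_mem_Z hj x.2), EmbeddingLike.apply_eq_iff_eq, mkE_eq_iff]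
  have h := C.cobdDefect_mem i j x.1 x.2.1
  have hd : cobd K.X i x.1 ∈ K.F (j + r) (.mk (i + 1)) := x.2.2
  change cobd K.X i x.1 - (cobd K.X i x.1 + C.cobdDefect i x.1) ∈ _
  rw [sub_add_cancel_left]
  refine neg_mem (mem_B_of_mem_Z ⟨K.antitone (by omega) _ h, ?_⟩)
  change cobd K.X (i + 1) (C.cobdDefect i x.1) ∈ K.F (j' + 1 + (r - 1)) (.mk (i + 1 + 1))
  rw [C.cobd_cobdDefect]
  exact neg_mem (K.antitone (by omega) _
    (C.cobdDefect_mem (i + 1) (j + r) _ (add_mem hd (K.antitone (by omega) _ h))))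

/-- Every page uses the same underlying map, so this reduces to `mem_B_succ`. -/
theorem pageEquiv_succ (hq : 1 ≤ q) {r : ℤ} (hr : r + 1 ≤ q) (i : ℕ) (j : ℤ) (a b)
    (ha : a ∈ K.Z r i j) (ha' : a ∈ K.Z (r + 1) i j) (hb : b ∈ L.Z r i j)
    (hb' : b ∈ L.Z (r + 1) i j)
    (h : C.pageEquiv hq (by omega) i j (K.mkE r i j ⟨a, ha⟩) = L.mkE r i j ⟨b, hb⟩) :
    C.pageEquiv hq hr i j (K.mkE (r + 1) i j ⟨a, ha'⟩) = L.mkE (r + 1) i j ⟨b, hb'⟩ := by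
  rw [pageEquiv_mkE_eq_iff] at h ⊢
  exact mem_B_succ h (sub_mem ((C.map_mem_Z_iff hr).2 ha') hb')

end Comparison

end TruncExp

namespace TruncExp

/-! ### The truncated exponential -/

section TruncatedExp

variable (R : Type) [CommRing R] {p : ℕ} {U : Type*} [CommRing U] [Algebra R U] {J : Ideal U}

/-- The inverse of `n!` in `R`, if it exists. -/
noncomputable abbrev invFactorial (n : ℕ) : R := Ring.inverse ((n ! : ℕ) : R)

/-- The truncated exponential `∑_{n < p} xⁿ / n!`. -/
noncomputable def truncExp (R : Type) [CommRing R] (p : ℕ) {U : Type*} [CommRing U] [Algebra R U] (x : U) : U :=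
  ∑ n ∈ Finset.range p, invFactorial R n • x ^ n

theorem truncExp_zero (hp : 0 < p) : truncExp R p (0 : U) = 1 := by
  rw [truncExp, Finset.sum_eq_single_of_mem 0 (Finset.mem_range.2 hp)
    fun n _ hn => by rw [zero_pow hn, smul_zero]]
  simp [invFactorial]

/-- For `n ≥ 2`, `xⁿ - yⁿ` is `x - y` times an element of `J`. So `truncExp` preserves differences
to leading order, which drives injectivity, surjectivity and compatibility with the filtration. -/
theorem truncExp_sub_truncExp_sub_mem (hp : 2 ≤ p) {x y : U} (hx : x ∈ J) (hy : y ∈ J) {k : ℕ}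
    (hxy : x - y ∈ J ^ k) : truncExp R p x - truncExp R p y - (x - y) ∈ J ^ (k + 1) := by
  have h : ∀ z : U, truncExp R p z =
      1 + z + ∑ n ∈ Finset.range (p - 2), invFactorial R (n + 2) • z ^ (n + 2) := fun z => by
    obtain ⟨m, rfl⟩ := Nat.exists_eq_add_of_le' hp
    rw [truncExp, Finset.sum_range_succ', Finset.sum_range_succ']
    simp [invFactorial]
    abel
  have hs : truncExp R p x - truncExp R p y - (x - y) = ∑ n ∈ Finset.range (p - 2),
      invFactorial R (n + 2) • (x ^ (n + 2) - y ^ (n + 2)) := by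
    rw [h, h, Finset.sum_congr rfl fun n _ => smul_sub _ _ _, Finset.sum_sub_distrib]
    ring
  rw [hs]
  refine sum_mem fun n _ => Submodule.smul_of_tower_mem _ _ ?_
  rw [← Commute.geom_sum₂_mul (Commute.all x y), mul_comm, pow_succ]
  refine Ideal.mul_mem_mul hxy (sum_mem fun i hi => ?_)
  rcases Nat.eq_zero_or_pos i with rfl | h0
  · exact Ideal.mul_mem_left _ _ (Ideal.pow_mem_of_mem _ hy _ (by omega))
  · exact Ideal.mul_mem_right _ _ (Ideal.pow_mem_of_mem _ hx _ h0)

theorem sub_mem_of_truncExp_sub_truncExp_mem (hp : 2 ≤ p) {x y : U} (hx : x ∈ J) (hy : y ∈ J)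
    {j : ℕ} (h : truncExp R p x - truncExp R p y ∈ J ^ j) : x - y ∈ J ^ j := by
  suffices ∀ k ≤ j, x - y ∈ J ^ k from this j le_rfl
  intro k hk
  induction k with
  | zero => simp
  | succ k ih =>
    have := truncExp_sub_truncExp_sub_mem R hp hx hy (ih (by omega))
    rw [← sub_sub_cancel (truncExp R p x - truncExp R p y) (x - y)]
    exact sub_mem (Ideal.pow_le_pow_right hk h) this

theorem exists_truncExp_sub_mem (hp : 2 ≤ p) {a : U} (ha : a ∈ J) (k : ℕ) :
    ∃ x ∈ J, truncExp R p x - (1 + a) ∈ J ^ (k + 1) := by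
  induction k with
  | zero =>
    refine ⟨0, zero_mem _, ?_⟩
    rw [truncExp_zero R (by omega), sub_add_cancel_left, zero_add, pow_one]
    exact neg_mem ha
  | succ k ih =>
    obtain ⟨x, hx, h⟩ := ih
    -- Successive approximation: subtracting the current error from `x` improves it by one power of
    -- `J`.
    have hx' : x - (truncExp R p x - (1 + a)) ∈ J :=
      sub_mem hx (Ideal.pow_le_self k.succ_ne_zero h)
    refine ⟨_, hx', ?_⟩
    have := truncExp_sub_truncExp_sub_mem R hp hx' hx
      (k := k + 1) (by rw [sub_sub_cancel_left]; exact neg_mem h)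
    convert this using 1
    ring

theorem smul_pow_eq_sum (hR : ∀ n < p, IsUnit ((n ! : ℕ) : R)) (n : ℕ) (hn : n < p) (x y : U) :
    invFactorial R n • (x + y) ^ n = ∑ m ∈ Finset.HasAntidiagonal.antidiagonal n,
      (invFactorial R m.1 * invFactorial R m.2) • (x ^ m.1 * y ^ m.2) := by
  rw [(Commute.all x y).add_pow', Finset.smul_sum]
  refine Finset.sum_congr rfl fun m hm => ?_
  have hm := Finset.HasAntidiagonal.mem_antidiagonal.1 hm
  rw [← Nat.cast_smul_eq_nsmul (R), smul_smul]
  congr 1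
  have h : ((n.choose m.1 : ℕ) : R) * (m.1 ! : ℕ) * (m.2 ! : ℕ) = (n ! : ℕ) := by
    rw [← Nat.cast_mul, ← Nat.cast_mul, ← hm, Nat.choose_symm_add, Nat.add_choose_mul_factorial_mul_factorial]
  have h0 := Ring.inverse_mul_cancel _ (hR n hn)
  have h1 := Ring.mul_inverse_cancel _ (hR m.1 (by omega))
  have h2 := Ring.mul_inverse_cancel _ (hR m.2 (by omega))
  unfold invFactorial
  generalize Ring.inverse ((n ! : ℕ) : R) = a at *
  generalize Ring.inverse ((m.1 ! : ℕ) : R) = b at *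
  generalize Ring.inverse ((m.2 ! : ℕ) : R) = c at *
  rw [← h] at h0
  calc a * ((n.choose m.1 : ℕ) : R)
      = a * ((n.choose m.1 : ℕ) : R) * (((m.1 ! : ℕ) : R) * b) *
          (((m.2 ! : ℕ) : R) * c) := by rw [h1, h2, mul_one, mul_one]
    _ = (a * (((n.choose m.1 : ℕ) : R) * (m.1 ! : ℕ) * (m.2 ! : ℕ))) * (b * c) := by ring
    _ = b * c := by rw [h0, one_mul]

/-- The truncated exponential is multiplicative up to a term of degree `p`. -/
theorem truncExp_mul_truncExp (hR : ∀ n < p, IsUnit ((n ! : ℕ) : R)) (hJ : J ^ (p + 1) = ⊥) {x y : U} (hx : x ∈ J)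
    (hy : y ∈ J) :
    truncExp R p x * truncExp R p y = truncExp R p (x + y) + ∑ a ∈ Finset.Ioo 0 p,
      (invFactorial R a * invFactorial R (p - a)) • (x ^ a * y ^ (p - a)) := by
  -- The product is the sum of `F` over a square of exponents, sorted by total degree: below `p` it
  -- gives `truncExp (x + y)`, in degree `p` the remainder, and above `p` it vanishes.
  let F : ℕ × ℕ → U := fun m => (invFactorial R m.1 * invFactorial R m.2) • (x ^ m.1 * y ^ m.2)
  have h1 : truncExp R p x * truncExp R p y = ∑ m ∈ Finset.range p ×ˢ Finset.range p, F m := by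
    rw [truncExp, truncExp, Finset.sum_mul_sum, Finset.sum_product]
    exact Finset.sum_congr rfl fun a _ => Finset.sum_congr rfl fun b _ => smul_mul_smul_comm _ _ _ _
  have h2 : ∀ n ∈ Finset.range p, invFactorial R n • (x + y) ^ n =
      ∑ m ∈ Finset.range p ×ˢ Finset.range p with m.1 + m.2 = n, F m := fun n hn => by
    have hn := Finset.mem_range.1 hn
    rw [smul_pow_eq_sum R hR n hn]
    refine Finset.sum_congr ?_ fun _ _ => rfl
    ext m
    simp only [Finset.HasAntidiagonal.mem_antidiagonal, Finset.mem_filter, Finset.mem_product, Finset.mem_range]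
    omega
  have h3 : ∑ a ∈ Finset.Ioo 0 p,
      (invFactorial R a * invFactorial R (p - a)) • (x ^ a * y ^ (p - a)) =
      ∑ m ∈ Finset.range p ×ˢ Finset.range p with m.1 + m.2 = p, F m := by
    refine Finset.sum_bij' (fun a _ => (a, p - a)) (fun m _ => m.1) ?_ ?_ ?_ ?_ ?_
    · intro a ha
      simp only [Finset.mem_Ioo] at ha
      simp only [Finset.mem_filter, Finset.mem_product, Finset.mem_range]
      omega
    · intro m hm
      simp only [Finset.mem_filter, Finset.mem_product, Finset.mem_range] at hm
      simp only [Finset.mem_Ioo]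
      omega
    · intro a _
      rfl
    · intro m hm
      simp only [Finset.mem_filter, Finset.mem_product, Finset.mem_range] at hm
      ext
      · rfl
      · change p - m.1 = m.2
        omega
    · intro a _
      rfl
  have h4 : ∀ m : ℕ × ℕ, p < m.1 + m.2 → F m = 0 := fun m hm => by
    have : x ^ m.1 * y ^ m.2 ∈ J ^ (p + 1) := by
      refine Ideal.pow_le_pow_right (show p + 1 ≤ m.1 + m.2 from hm) ?_
      rw [pow_add]
      exact Ideal.mul_mem_mul (Ideal.pow_mem_pow hx _) (Ideal.pow_mem_pow hy _)
    rw [hJ, Ideal.mem_bot] at this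
    simp only [F, this, smul_zero]
  rw [h1, truncExp, Finset.sum_congr rfl h2, h3, ← Finset.sum_range_succ
    (fun n => ∑ m ∈ Finset.range p ×ˢ Finset.range p with m.1 + m.2 = n, F m),
    Finset.sum_fiberwise_eq_sum_filter, Finset.sum_filter]
  refine Finset.sum_congr rfl fun m _ => ?_
  split_ifs with h
  · rfl
  · exact h4 m (by simpa using h)

end TruncatedExp

/-! ### The augmentation ideal of the unitization -/

section Augmentation

variable {R : Type} [CommRing R] {A : Type u} [NonUnitalCommRing A] [Module R A]
  [IsScalarTower R A A] [SMulCommClass R A A]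

variable (R A) in
/-- The ideal `A` of the unitization of `A`. -/
noncomputable def augIdeal : Ideal (Unitization R A) :=
  RingHom.ker (Unitization.fstHom R A)

theorem mem_augIdeal {z : Unitization R A} : z ∈ augIdeal R A ↔ z.fst = 0 := Iff.rfl

theorem inr_mem_augIdeal (a : A) : (a : Unitization R A) ∈ augIdeal R A :=
  mem_augIdeal.2 (Unitization.fst_inr R a)

/-- Lets computations take place in a unital ring with honest ideal powers. The exponent must be
positive, since the zeroth power is the whole unitization. -/
theorem mem_augIdeal_pow_iff {j : ℕ} {z : Unitization R A} :
    z ∈ augIdeal R A ^ (j + 1) ↔ ∃ a ∈ nuPow R A (j + 1), (a : Unitization R A) = z := by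
  constructor
  · induction j generalizing z with
    | zero =>
      rw [zero_add, pow_one, mem_augIdeal]
      exact fun h => ⟨z.snd, trivial, Unitization.ext (by simp [h]) (by simp)⟩
    | succ j ih =>
      intro h
      rw [pow_succ'] at h
      refine Submodule.mul_induction_on h (fun z hz w hw => ?_) fun z w hz hw => ?_
      · obtain ⟨b, hb, rfl⟩ := ih hw
        refine ⟨z.snd * b, mul_mem_nuPow_succ j.succ_pos _ hb, ?_⟩
        rw [Unitization.inr_mul]
        congr 1
        exact Unitization.ext (by simp [mem_augIdeal.1 hz]) (by simp)
      · obtain ⟨a, ha, rfl⟩ := hz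
        obtain ⟨b, hb, rfl⟩ := hw
        exact ⟨a + b, add_mem ha hb, Unitization.inr_add _ _ _⟩
  · rintro ⟨a, ha, rfl⟩
    induction j generalizing a with
    | zero =>
      rw [zero_add, pow_one]
      exact inr_mem_augIdeal a
    | succ j ih =>
      refine Submodule.span_induction (p := fun x _ =>
        (x : Unitization R A) ∈ augIdeal R A ^ (j + 1 + 1))
          (s := {z | ∃ x : A, ∃ y ∈ nuPow R A (j + 1), x * y = z}) ?_ ?_ ?_ ?_ ha
      · rintro _ ⟨x, y, hy, rfl⟩
        rw [Unitization.inr_mul, pow_succ']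
        exact Ideal.mul_mem_mul (inr_mem_augIdeal x) (ih y hy)
      · rw [Unitization.inr_zero]; exact zero_mem _
      · intro x y _ _ hx hy
        rw [Unitization.inr_add]; exact add_mem hx hy
      · intro r x _ hx
        rw [Unitization.inr_smul]
        exact Submodule.smul_of_tower_mem _ r hx

theorem inr_mem_augIdeal_pow_iff {j : ℕ} (hj : 1 ≤ j) {a : A} :
    (a : Unitization R A) ∈ augIdeal R A ^ j ↔ a ∈ nuPow R A j := by
  obtain ⟨j, rfl⟩ := Nat.exists_eq_add_of_le' hj
  rw [mem_augIdeal_pow_iff]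
  exact ⟨fun ⟨b, hb, h⟩ => Unitization.inr_injective h ▸ hb, fun h => ⟨a, h, rfl⟩⟩

theorem augIdeal_pow_eq_bot {n : ℕ} (h : nuPow R A (n + 1) = ⊥) : augIdeal R A ^ (n + 1) = ⊥ := by
  rw [eq_bot_iff]
  intro z hz
  obtain ⟨a, ha, rfl⟩ := mem_augIdeal_pow_iff.1 hz
  rw [h, Submodule.mem_bot] at ha
  rw [ha, Unitization.inr_zero]
  exact zero_mem _

end Augmentation

end TruncExp

namespace TruncExp

/-! ### The truncated exponential of a nilpotent algebra -/

section NilpotentExp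

section General

variable {R : Type} [CommRing R] {A : Type u} [NonUnitalCommRing A] [Module R A]
  [IsScalarTower R A A] [SMulCommClass R A A]

variable (R) in
/-- The element `1 + x` of the unitization. -/
noncomputable def OnePlus.toUnitization (g : OnePlus A) : Unitization R A :=
  1 + ((OnePlus.val g : A) : Unitization R A)

theorem OnePlus.val_injective : Function.Injective (OnePlus.val (A := A)) := by
  intro g h e
  apply Additive.toMul.injective
  apply Units.ext
  exact PreQuasiregular.equiv.symm.injective e

theorem OnePlus.toUnitization_injective :
    Function.Injective (OnePlus.toUnitization R (A := A)) := fun _ _ h =>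
  OnePlus.val_injective (Unitization.inr_injective (add_left_cancel h))

theorem OnePlus.toUnitization_add (g h : OnePlus A) :
    (g + h).toUnitization R = g.toUnitization R * h.toUnitization R := by
  have hv : (g + h).val = h.val + g.val + g.val * h.val := rfl
  rw [toUnitization, hv, toUnitization, toUnitization, Unitization.inr_add, Unitization.inr_add,
    Unitization.inr_mul]
  ring

theorem OnePlus.toUnitization_zero : (0 : OnePlus A).toUnitization R = 1 := by
  have hv : (0 : OnePlus A).val = 0 := rfl
  rw [toUnitization, hv, Unitization.inr_zero, add_zero]

variable {p : ℕ}

/-- As `a` is nilpotent, `1 + a` is a unit with scalar part one, and such units correspond to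
elements of `OnePlus A`. -/
theorem OnePlus.exists_toUnitization_eq (h : nuPow R A (p + 1) = ⊥) (a : A) :
    ∃ g : OnePlus A, g.toUnitization R = 1 + (a : Unitization R A) := by
  have hn : IsNilpotent (a : Unitization R A) := ⟨p + 1, by
    have := Ideal.pow_mem_pow (inr_mem_augIdeal (R := R) a) (p + 1)
    rwa [augIdeal_pow_eq_bot h, Ideal.mem_bot] at this⟩
  let u : Unitization.unitsFstOne R A := ⟨hn.isUnit_one_add.unit, by simp⟩
  refine ⟨Additive.ofMul (Unitization.unitsFstOne_mulEquiv_quasiregular R u), ?_⟩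
  change 1 + ((1 + (a : Unitization R A)).snd : Unitization R A) = _
  simp

variable (R) in
/-- The element `1 + a` of the group `1 + A`, for nilpotent `A`. -/
noncomputable def OnePlus.of (h : nuPow R A (p + 1) = ⊥) (a : A) : OnePlus A :=
  (OnePlus.exists_toUnitization_eq h a).choose

theorem OnePlus.toUnitization_of (h : nuPow R A (p + 1) = ⊥) (a : A) :
    (OnePlus.of R h a).toUnitization R = 1 + (a : Unitization R A) :=
  (OnePlus.exists_toUnitization_eq h a).choose_spec

/-- The truncated exponential as a map `A → 1 + A`. -/
noncomputable def nilExp (h : nuPow R A (p + 1) = ⊥) (x : A) : OnePlus A :=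
  OnePlus.of R h (truncExp R p (x : Unitization R A)).snd

theorem truncExp_sub_one_sub_mem (hp : 2 ≤ p) {k : ℕ} {x : Unitization R A}
    (hx : x ∈ augIdeal R A) (hx' : x ∈ augIdeal R A ^ k) :
    truncExp R p x - 1 - x ∈ augIdeal R A ^ (k + 1) := by
  have := truncExp_sub_truncExp_sub_mem R hp hx (zero_mem _) (k := k) (by rwa [sub_zero])
  rwa [sub_zero, truncExp_zero R (by omega)] at this

theorem truncExp_sub_one_mem (hp : 2 ≤ p) {k : ℕ} {x : Unitization R A}
    (hx : x ∈ augIdeal R A) (hx' : x ∈ augIdeal R A ^ k) :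
    truncExp R p x - 1 ∈ augIdeal R A ^ k := by
  rw [← sub_add_cancel (truncExp R p x - 1) x]
  exact add_mem (Ideal.pow_le_pow_right k.le_succ (truncExp_sub_one_sub_mem hp hx hx')) hx'

theorem toUnitization_nilExp (hp : 2 ≤ p) (h : nuPow R A (p + 1) = ⊥) (x : A) :
    (nilExp h x).toUnitization R = truncExp R p (x : Unitization R A) := by
  have hx := inr_mem_augIdeal (R := R) x
  have h1 : (truncExp R p (x : Unitization R A) - 1).fst = 0 := by
    have := truncExp_sub_one_mem hp (k := 1) hx (by rwa [pow_one])
    rwa [pow_one] at this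
  have h1 : (truncExp R p (x : Unitization R A)).fst = 1 := by
    rw [← sub_eq_zero, ← h1, sub_eq_add_neg, sub_eq_add_neg]
    rfl
  rw [nilExp, OnePlus.toUnitization_of]
  exact Unitization.ext (by simp [h1]) (by simp)

theorem nilExp_injective (hp : 2 ≤ p) (h : nuPow R A (p + 1) = ⊥) :
    Function.Injective (nilExp h) := by
  intro x y e
  have e := congrArg (OnePlus.toUnitization R) e
  rw [toUnitization_nilExp hp, toUnitization_nilExp hp] at e
  have := sub_mem_of_truncExp_sub_truncExp_mem R hp (inr_mem_augIdeal (R := R) x)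
    (inr_mem_augIdeal y) (j := p + 1) (by rw [e, sub_self]; exact zero_mem _)
  rw [augIdeal_pow_eq_bot h, Ideal.mem_bot, sub_eq_zero] at this
  exact Unitization.inr_injective this

theorem nilExp_surjective (hp : 2 ≤ p) (h : nuPow R A (p + 1) = ⊥) :
    Function.Surjective (nilExp h) := by
  intro g
  obtain ⟨x, hx, e⟩ := exists_truncExp_sub_mem R hp (inr_mem_augIdeal (R := R) g.val) p
  obtain ⟨a, rfl⟩ : ∃ a : A, (a : Unitization R A) = x :=
    ⟨x.snd, Unitization.ext (mem_augIdeal.1 hx).symm rfl⟩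
  rw [augIdeal_pow_eq_bot h, Ideal.mem_bot, sub_eq_zero] at e
  refine ⟨a, OnePlus.toUnitization_injective (R := R) ?_⟩
  rw [toUnitization_nilExp hp, e]
  rfl

theorem nilExp_mem_iff (hp : 2 ≤ p) (h : nuPow R A (p + 1) = ⊥) (j : ℕ) (x : A) :
    nilExp h x ∈ onePlusPow R A j ↔ x ∈ nuPow R A j := by
  have hx := inr_mem_augIdeal (R := R) x
  rcases Nat.eq_zero_or_pos j with rfl | hj
  · exact iff_of_true trivial trivial
  have hv : (((nilExp h x).val : A) : Unitization R A) = truncExp R p (x : Unitization R A) - 1 :=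
    eq_sub_of_add_eq' (toUnitization_nilExp hp h x)
  change (nilExp h x).val ∈ nuPow R A j ↔ _
  rw [← inr_mem_augIdeal_pow_iff hj, ← inr_mem_augIdeal_pow_iff hj, hv]
  refine ⟨fun h => ?_, truncExp_sub_one_mem hp hx⟩
  have := sub_mem_of_truncExp_sub_truncExp_mem R hp hx (zero_mem _) (j := j)
    (by rwa [truncExp_zero R (by omega)])
  rwa [sub_zero] at this

theorem nilExp_zero (hp : 2 ≤ p) (h : nuPow R A (p + 1) = ⊥) : nilExp h 0 = 0 :=
  OnePlus.toUnitization_injective (R := R) (by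
    rw [toUnitization_nilExp hp, Unitization.inr_zero, truncExp_zero R (by omega),
      OnePlus.toUnitization_zero])

theorem inr_mul_inr_eq_zero (h : nuPow R A (p + 1) = ⊥) (hp : 1 ≤ p) (x : A) {z : A}
    (hz : z ∈ nuPow R A p) : (x : Unitization R A) * z = 0 := by
  have := mul_mem_nuPow_succ hp x hz
  rw [h, Submodule.mem_bot] at this
  rw [← Unitization.inr_mul, this, Unitization.inr_zero]

/-- The homomorphism `z ↦ 1 + z` from the last nonzero power of `A`. -/
noncomputable def topOnePlus (h : nuPow R A (p + 1) = ⊥) (hp : 1 ≤ p) :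
    nuPow R A p →+ OnePlus A :=
  AddMonoidHom.mk' (fun z => OnePlus.of R h z.1) fun y z =>
    OnePlus.toUnitization_injective (R := R) (by
      rw [OnePlus.toUnitization_add, OnePlus.toUnitization_of, OnePlus.toUnitization_of,
        OnePlus.toUnitization_of, Submodule.coe_add, Unitization.inr_add]
      linear_combination -inr_mul_inr_eq_zero h hp y.1 z.2)

theorem truncExp_sub_one_mul_eq_zero (hp : 2 ≤ p) (h : nuPow R A (p + 1) = ⊥) (x : A) {z : A}
    (hz : z ∈ nuPow R A p) :
    (truncExp R p (x : Unitization R A) - 1) * (z : Unitization R A) = 0 := by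
  have := Ideal.mul_mem_mul (truncExp_sub_one_mem hp (k := 1) (inr_mem_augIdeal (R := R) x)
    (by rw [pow_one]; exact inr_mem_augIdeal x))
    ((inr_mem_augIdeal_pow_iff (R := R) (show 1 ≤ p by omega)).2 hz)
  rwa [← pow_add, add_comm, augIdeal_pow_eq_bot h, Ideal.mem_bot] at this

/-- Since `A · Aᵖ = 0`, both multiplying by `1 + z` and shifting the argument by `z` just add `z`.
This moves multiplicative corrections inside the exponential. -/
theorem nilExp_add_topOnePlus (hp : 2 ≤ p) (h : nuPow R A (p + 1) = ⊥) (x : A)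
    (z : nuPow R A p) :
    nilExp h x + topOnePlus h (by omega) z = nilExp h (x + z.1) := by
  apply OnePlus.toUnitization_injective (R := R)
  have hx := inr_mem_augIdeal (R := R) x
  have hz := (inr_mem_augIdeal_pow_iff (R := R) (show 1 ≤ p by omega)).2 z.2
  have h1 := truncExp_sub_truncExp_sub_mem R hp (inr_mem_augIdeal (R := R) (x + z.1)) hx (k := p)
    (by rwa [Unitization.inr_add, add_sub_cancel_left])
  rw [augIdeal_pow_eq_bot h, Ideal.mem_bot, Unitization.inr_add] at h1
  have h2 := truncExp_sub_one_mul_eq_zero hp h x z.2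
  rw [OnePlus.toUnitization_add, toUnitization_nilExp hp, toUnitization_nilExp hp]
  change _ * (OnePlus.of R h z.1).toUnitization R = _
  rw [OnePlus.toUnitization_of, Unitization.inr_add]
  linear_combination h2 - h1

theorem inr_symMul_tprod_mk {n : ℕ} (hn : 1 ≤ n) (h : nuPow R A (n + 1) = ⊥) (v : Fin n → A) :
    ((symMul h (SymmetricPower.tprod R fun a => Submodule.Quotient.mk (v a)) : A) :
      Unitization R A) = ∏ a, (v a : Unitization R A) := by
  rw [symMul_tprod_mk, nuProd_apply]
  refine Unitization.ext ?_ (Unitization.snd_inr _ _)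
  rw [Unitization.fst_inr]
  refine (mem_augIdeal.1 ?_).symm
  rw [← Finset.mul_prod_erase _ _ (Finset.mem_univ (⟨0, hn⟩ : Fin n))]
  exact Ideal.mul_mem_right _ _ (inr_mem_augIdeal _)

/-- The truncated exponential is natural. -/
theorem map_nilExp (hp : 2 ≤ p) {B : Type u} [NonUnitalCommRing B] [Module R B]
    [IsScalarTower R B B] [SMulCommClass R B B] (hA : nuPow R A (p + 1) = ⊥)
    (hB : nuPow R B (p + 1) = ⊥) (f : A →ₙₐ[R] B) (x : A) :
    f (nilExp hA x).val = (nilExp hB (f x)).val := by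
  let g : Unitization R A →ₐ[R] Unitization R B :=
    Unitization.lift ((Unitization.inrNonUnitalAlgHom R B).comp f)
  have hg : ∀ a : A, g (a : Unitization R A) = ((f a : B) : Unitization R B) := fun a => by
    simp [g]
  apply Unitization.inr_injective (R := R)
  rw [← hg]
  have h1 := toUnitization_nilExp hp hA x
  have h2 := toUnitization_nilExp hp hB (f x)
  rw [OnePlus.toUnitization] at h1 h2
  rw [eq_sub_of_add_eq' h1, eq_sub_of_add_eq' h2, map_sub, map_one, truncExp, map_sum, truncExp]
  simp only [map_smul, map_pow, hg]

end General

end NilpotentExp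

end TruncExp

namespace TruncExp

/-! ### Products of truncated exponentials in terms of `σ_p` and `μ_p` -/

section ExpSum

variable {p : ℕ} {A : Type u} [NonUnitalCommRing A] [Module (ZInv p) A]
  [IsScalarTower (ZInv p) A A] [SMulCommClass (ZInv p) A A]

/-- The multiplication map `Symᵖ(A/A²) → Aᵖ` followed by the inclusion in the unitization. -/
noncomputable def symMulInr (h : nuPow (ZInv p) A (p + 1) = ⊥) :
    Sym[ZInv p] (Fin p) (A ⧸ nuPow (ZInv p) A 2) →ₗ[ZInv p] Unitization (ZInv p) A :=
  Unitization.inrHom (ZInv p) (ZInv p) A ∘ₗ (nuPow (ZInv p) A p).subtype ∘ₗ symMul h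

theorem symMulInr_symMonomial (hp : 1 ≤ p) (h : nuPow (ZInv p) A (p + 1) = ⊥) {k : ℕ}
    (x : Fin k → A) (s : Sym (Fin k) p) :
    symMulInr h (symMonomial p (fun l => Submodule.Quotient.mk (x l)) s) =
      ∏ l, (x l : Unitization (ZInv p) A) ^ s.1.count l := by
  refine (inr_symMul_tprod_mk hp h fun a : Fin p =>
    x (s.1.toList.get (Fin.cast (by rw [Multiset.length_toList, s.2]) a))).trans ?_
  have h1 := congrArg (fun t => (t.map fun l => (x l : Unitization (ZInv p) A)).prod)
    (map_univ_toList_get s.1 s.2)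
  simp only [Multiset.map_map] at h1
  refine h1.trans ?_
  rw [Finset.prod_multiset_map_count]
  refine Finset.prod_subset (Finset.subset_univ _) fun l _ hl => ?_
  rw [Multiset.count_eq_zero_of_notMem (by simpa using hl), pow_zero]

theorem mk_pair (x y : A) : (fun l => Submodule.Quotient.mk (![x, y] l)) =
    (![Submodule.Quotient.mk x, Submodule.Quotient.mk y] : Fin 2 → A ⧸ nuPow (ZInv p) A 2) :=
  funext (Fin.forall_fin_two.2 ⟨rfl, rfl⟩)

theorem symMulInr_sigma_pair (hp : 1 ≤ p) (h : nuPow (ZInv p) A (p + 1) = ⊥) (x y : A) :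
    symMulInr h (sigma p ![Submodule.Quotient.mk x, Submodule.Quotient.mk y]) =
      ∑ a ∈ Finset.Ioo 0 p, (invFactorial (ZInv p) a * invFactorial (ZInv p) (p - a)) •
        ((x : Unitization (ZInv p) A) ^ a * (y : Unitization (ZInv p) A) ^ (p - a)) := by
  have hc : ∀ s : Sym (Fin 2) p, s.1.count 0 + s.1.count 1 = p := fun s => by
    rw [← Fin.sum_univ_two (fun l => s.1.count l),
      Multiset.sum_count_eq_card (fun _ _ => Finset.mem_univ _), s.2]
  rw [← mk_pair, sigma, map_sum]
  -- A multiset of size `p` on two letters is determined by the multiplicity `a` of the first; both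
  -- multiplicities are at most `p - 1` exactly when `0 < a < p`.
  refine Finset.sum_bij' (fun s _ => s.1.count 0)
    (fun a ha => ⟨Multiset.replicate a 0 + Multiset.replicate (p - a) 1, by
      have := (Finset.mem_Ioo.1 ha).2
      rw [Multiset.card_add, Multiset.card_replicate, Multiset.card_replicate]
      omega⟩) ?_ ?_ ?_ ?_ ?_
  · intro s hs
    have h0 := (Finset.mem_filter.1 hs).2 0
    have h1 := (Finset.mem_filter.1 hs).2 1
    have := hc s
    rw [Finset.mem_Ioo]
    omega
  · intro a ha
    have ha := Finset.mem_Ioo.1 ha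
    refine Finset.mem_filter.2 ⟨Finset.mem_univ _, fun l => ?_⟩
    fin_cases l <;> simp [Multiset.count_replicate] <;> omega
  · intro s hs
    have h1 : p - s.1.count 0 = s.1.count 1 := by have := hc s; omega
    refine Subtype.ext (Multiset.ext.2 (Fin.forall_fin_two.2 ⟨?_, ?_⟩))
    · simp [Multiset.count_replicate]
    · refine Eq.trans ?_ h1
      simp [Multiset.count_replicate]
  · intro a ha
    simp [Multiset.count_replicate]
  · intro s hs
    rw [map_smul, symMulInr_symMonomial hp, Fin.prod_univ_two, Fin.prod_univ_two]
    have h1 : s.1.count 1 = p - s.1.count 0 := by have := hc s; omega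
    rw [h1]
    rfl

/-- `σ_p` of elements of `A`, evaluated in `A`. -/
noncomputable def sigmaTop (h : nuPow (ZInv p) A (p + 1) = ⊥) {k : ℕ} (x : Fin k → A) :
    nuPow (ZInv p) A p :=
  symMul h (sigma p fun l => Submodule.Quotient.mk (x l))

theorem sigmaTop_pair (h : nuPow (ZInv p) A (p + 1) = ⊥) (x y : A) :
    sigmaTop h ![x, y] =
      symMul h (sigma p ![Submodule.Quotient.mk x, Submodule.Quotient.mk y]) := by
  rw [sigmaTop, mk_pair]

theorem sigmaTop_pair_eq_zero (hp : 0 < p) (h : nuPow (ZInv p) A (p + 1) = ⊥) (x : A) {y : A}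
    (hy : y ∈ nuPow (ZInv p) A 2) : sigmaTop h ![x, y] = 0 := by
  rw [sigmaTop_pair, (Submodule.Quotient.mk_eq_zero _).2 hy, sigma_zero_right hp, map_zero]

/-- The degree `p` remainder in `truncExp_mul_truncExp` is `σ_p(x, y)`. Adding it equals multiplying
by `1 + σ_p(x, y)`, because `e(x + y) - 1` annihilates `Aᵖ`. -/
theorem nilExp_add (hp : 2 ≤ p) (h : nuPow (ZInv p) A (p + 1) = ⊥) (x y : A) :
    nilExp h x + nilExp h y =
      nilExp h (x + y) + topOnePlus h (by omega) (sigmaTop h ![x, y]) := by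
  have hs := symMulInr_sigma_pair (by omega) h x y
  change ((symMul h _ : A) : Unitization (ZInv p) A) = _ at hs
  rw [← sigmaTop_pair] at hs
  have hx := inr_mem_augIdeal (R := ZInv p) x
  have hy := inr_mem_augIdeal (R := ZInv p) y
  have h2 := truncExp_sub_one_mul_eq_zero hp h (x + y) (sigmaTop h ![x, y]).2
  apply OnePlus.toUnitization_injective (R := ZInv p)
  rw [OnePlus.toUnitization_add, OnePlus.toUnitization_add, toUnitization_nilExp hp,
    toUnitization_nilExp hp, toUnitization_nilExp hp, truncExp_mul_truncExp (ZInv p)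
      (fun n hn => isUnit_factorial (by omega)) (augIdeal_pow_eq_bot h) hx hy, ← hs]
  change _ = _ * (OnePlus.of (ZInv p) h (sigmaTop h ![x, y]).1).toUnitization (ZInv p)
  rw [OnePlus.toUnitization_of, Unitization.inr_add] at *
  linear_combination -h2

theorem sum_nilExp (hp : 2 ≤ p) (h : nuPow (ZInv p) A (p + 1) = ⊥) {k : ℕ} (x : Fin k → A) :
    ∑ l, nilExp h (x l) =
      nilExp h (∑ l, x l) + topOnePlus h (by omega) (sigmaTop h x) := by
  induction k with
  | zero =>
    have h0 : sigmaTop h x = 0 := by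
      have : IsEmpty (Sym (Fin 0) p) := ⟨fun s => by
        have h1 := s.2
        rw [Multiset.eq_zero_of_forall_notMem (s := s.1) fun a => a.elim0] at h1
        simp at h1
        omega⟩
      rw [sigmaTop, sigma, Finset.univ_eq_empty, Finset.filter_empty, Finset.sum_empty, map_zero]
    rw [h0, map_zero, add_zero, Finset.univ_eq_empty, Finset.sum_empty, Finset.sum_empty,
      nilExp_zero hp]
  | succ k ih =>
    have hs : sigmaTop h x = sigmaTop h (fun l : Fin k => x l.castSucc) +
        sigmaTop h ![∑ l : Fin k, x l.castSucc, x (Fin.last k)] := by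
      rw [sigmaTop_pair, sigmaTop, sigma_snoc (by omega), map_add]
      have h1 := map_sum (Submodule.mkQ (nuPow (ZInv p) A 2)) (fun l : Fin k => x l.castSucc)
        Finset.univ
      simp only [Submodule.mkQ_apply] at h1
      rw [h1]
      rfl
    rw [Fin.sum_univ_castSucc, ih, Fin.sum_univ_castSucc, hs, map_add, add_right_comm,
      nilExp_add hp]
    abel

/-- `μ_p` of elements of `A`, evaluated in `A`. -/
noncomputable def muTop (h : nuPow (ZInv p) A (p + 1) = ⊥) {k : ℕ} (y : Fin k → A) :
    nuPow (ZInv p) A p :=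
  symMul h (mu p fun l => Submodule.Quotient.mk (y l))

theorem muTop_eq_zero (hp : 0 < p) (h : nuPow (ZInv p) A (p + 1) = ⊥) {k : ℕ} {y : Fin k → A}
    (hy : ∀ l, y l ∈ nuPow (ZInv p) A 2) : muTop h y = 0 := by
  rw [muTop, funext fun l => (Submodule.Quotient.mk_eq_zero _).2 (hy l), mu_zero hp, map_zero]

/-- The inverse of `e(y)` is `e(-y)` divided by `1 + σ_p(y, -y)`; this is where the correction terms
of `μ_p` come from. -/
theorem sum_neg_one_pow_smul_nilExp (hp : 2 ≤ p) (h : nuPow (ZInv p) A (p + 1) = ⊥) {k : ℕ}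
    (y : Fin k → A) :
    ∑ l : Fin k, (-1 : ℤ) ^ (l : ℕ) • nilExp h (y l) =
      nilExp h (∑ l : Fin k, (-1 : ℤ) ^ (l : ℕ) • y l) + topOnePlus h (by omega) (muTop h y) := by
  have h1 : ∀ l : Fin k, (-1 : ℤ) ^ (l : ℕ) • nilExp h (y l) =
      nilExp h ((-1 : ℤ) ^ (l : ℕ) • y l) -
        if Odd l.val then topOnePlus h (by omega) (sigmaTop h ![y l, -y l]) else 0 := fun l => by
    split_ifs with hl
    · have := nilExp_add hp h (y l) (-y l)
      rw [add_neg_cancel, nilExp_zero hp, zero_add] at this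
      rw [hl.neg_one_pow, neg_smul, one_smul, neg_smul, one_smul, ← this]
      abel
    · rw [(Nat.not_odd_iff_even.1 hl).neg_one_pow, one_smul, one_smul, sub_zero]
  have h2 : muTop h y = sigmaTop h (fun l : Fin k => (-1 : ℤ) ^ (l : ℕ) • y l) -
      ∑ l : Fin k with Odd l.val, sigmaTop h ![y l, -y l] := by
    rw [muTop, mu, map_sub, map_sum]
    congr 1
    refine Finset.sum_congr rfl fun l _ => ?_
    rw [sigmaTop_pair]
    rfl
  have h3 : topOnePlus h (by omega) (muTop h y) = topOnePlus h (by omega)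
      (sigmaTop h (fun l : Fin k => (-1 : ℤ) ^ (l : ℕ) • y l)) -
      ∑ l : Fin k with Odd l.val, topOnePlus h (by omega) (sigmaTop h ![y l, -y l]) := by
    rw [h2, ← map_sum]
    exact map_sub (topOnePlus h _) _ _
  rw [Finset.sum_congr rfl fun l _ => h1 l, Finset.sum_sub_distrib, sum_nilExp hp, h3,
    Finset.sum_filter]
  abel

end ExpSum

/-! ### The comparison of the two filtrations -/

section Main

variable {p : ℕ} (𝔪 : CosimplicialObject (NUCommAlg.{u} (ZInv p)))
  (h𝔪 : ∀ n, nuPow (ZInv p) (𝔪.obj n) (p + 1) = ⊥)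

/-- The operation `φ` evaluated in `𝔪`. -/
noncomputable def algPhi (i : ℕ) (x : (additiveFiltration 𝔪).X.obj (.mk i)) :
    (additiveFiltration 𝔪).X.obj (.mk (i + 1)) :=
  (muTop (A := 𝔪.obj (.mk (i + 1))) (h𝔪 (.mk (i + 1)))
    fun k : Fin (i + 2) => NUCommAlg.algHom (𝔪.δ k) x).1

/-- The operation `σ_p` evaluated in `𝔪`. -/
noncomputable def algSigma (i : ℕ) (x y : (additiveFiltration 𝔪).X.obj (.mk i)) :
    (additiveFiltration 𝔪).X.obj (.mk i) :=
  (sigmaTop (A := 𝔪.obj (.mk i)) (h𝔪 (.mk i)) ![x, y]).1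

/-- The truncated exponential on `𝔪`. -/
noncomputable def algExp (i : ℕ) (x : (additiveFiltration 𝔪).X.obj (.mk i)) :
    (multiplicativeFiltration 𝔪).X.obj (.mk i) :=
  nilExp (A := 𝔪.obj (.mk i)) (h𝔪 (.mk i)) x

theorem cobd_algExp (hp : 2 ≤ p) (i : ℕ) (x : (additiveFiltration 𝔪).X.obj (.mk i)) :
    cobd (multiplicativeFiltration 𝔪).X i (algExp 𝔪 h𝔪 i x) =
      algExp 𝔪 h𝔪 (i + 1) (cobd (additiveFiltration 𝔪).X i x + algPhi 𝔪 h𝔪 i x) := by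
  have h : ∀ k : Fin (i + 2), ((multiplicativeFiltration 𝔪).X.δ k).hom (algExp 𝔪 h𝔪 i x) =
      algExp 𝔪 h𝔪 (i + 1) (NUCommAlg.algHom (𝔪.δ k) x) := fun k =>
    OnePlus.val_injective (map_nilExp hp (h𝔪 (.mk i)) (h𝔪 (.mk (i + 1)))
      (NUCommAlg.algHom (𝔪.δ k)) x)
  have h1 := (sum_neg_one_pow_smul_nilExp hp (h𝔪 (.mk (i + 1)))
    fun k : Fin (i + 2) => NUCommAlg.algHom (𝔪.δ k) x).trans (nilExp_add_topOnePlus hp _ _ _)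
  rw [cobd_eq_sum, cobd_eq_sum, Finset.sum_congr rfl fun k _ => congrArg _ (h k)]
  exact h1

/-- For `j ≤ 1` it suffices that the value lies in the `p`-th power. For `j ≥ 2`, `y` vanishes
modulo squares, and `σ_p(x, 0) = 0`. -/
theorem algSigma_mem (hp : 2 ≤ p) (i : ℕ) (j : ℤ) (x y : (additiveFiltration 𝔪).X.obj (.mk i))
    (hy : y ∈ (additiveFiltration 𝔪).F j (.mk i)) :
    algSigma 𝔪 h𝔪 i x y ∈ (additiveFiltration 𝔪).F (j + ((p : ℤ) - 1)) (.mk i) := by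
  rcases le_or_gt j 1 with hj | hj
  · exact nuPow_antitone (R := ZInv p) (A := 𝔪.obj (.mk i))
      (show (j + ((p : ℤ) - 1)).toNat ≤ p by omega) (sigmaTop (h𝔪 (.mk i)) ![x, y]).2
  · have h0 := sigmaTop_pair_eq_zero (by omega) (h𝔪 (.mk i)) x (nuPow_antitone (R := ZInv p)
      (A := 𝔪.obj (.mk i)) (show 2 ≤ j.toNat by omega) hy)
    rw [algSigma, h0]
    exact zero_mem _

theorem algPhi_mem (hp : 2 ≤ p) (i : ℕ) (j : ℤ) (x : (additiveFiltration 𝔪).X.obj (.mk i))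
    (hx : x ∈ (additiveFiltration 𝔪).F j (.mk i)) :
    algPhi 𝔪 h𝔪 i x ∈ (additiveFiltration 𝔪).F (j + ((p : ℤ) - 1)) (.mk (i + 1)) := by
  rcases le_or_gt j 1 with hj | hj
  · exact nuPow_antitone (R := ZInv p) (A := 𝔪.obj (.mk (i + 1)))
      (show (j + ((p : ℤ) - 1)).toNat ≤ p by omega) (muTop (h𝔪 (.mk (i + 1)))
        fun k : Fin (i + 2) => NUCommAlg.algHom (𝔪.δ k) x).2
  · have h0 := muTop_eq_zero (by omega) (h𝔪 (.mk (i + 1))) fun k : Fin (i + 2) =>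
      map_mem_nuPow (NUCommAlg.algHom (𝔪.δ k)) 2 (nuPow_antitone (R := ZInv p)
        (A := 𝔪.obj (.mk i)) (show 2 ≤ j.toNat by omega) hx)
    rw [algPhi, h0]
    exact zero_mem _

/-- The truncated exponential compares the filtrations of `𝔪` and `1 + 𝔪`. -/
noncomputable def expComparison (hp : 2 ≤ p) :
    Comparison (additiveFiltration 𝔪) (multiplicativeFiltration 𝔪) ((p : ℤ) - 1) where
  map := algExp 𝔪 h𝔪
  sumDefect := algSigma 𝔪 h𝔪
  cobdDefect := algPhi 𝔪 h𝔪
  bijective i := ⟨nilExp_injective hp (h𝔪 (.mk i)), nilExp_surjective hp (h𝔪 (.mk i))⟩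
  map_zero i := nilExp_zero hp (h𝔪 (.mk i))
  mem_iff i j x := nilExp_mem_iff hp (h𝔪 (.mk i)) j.toNat x
  map_add i x y := (nilExp_add hp (h𝔪 (.mk i)) x y).trans (nilExp_add_topOnePlus hp _ _ _)
  map_cobd := cobd_algExp 𝔪 h𝔪 hp
  sumDefect_mem := algSigma_mem 𝔪 h𝔪 hp
  cobdDefect_mem := algPhi_mem 𝔪 h𝔪 hp

theorem OnePlus.sub_mem_onePlusPow {R : Type} [CommRing R] {A : Type u} [NonUnitalCommRing A]
    [Module R A] [IsScalarTower R A A] [SMulCommClass R A A] {j : ℕ} {g h : OnePlus A}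
    (hgh : g.val - h.val ∈ nuPow R A j) : g - h ∈ onePlusPow R A j := by
  rcases Nat.eq_zero_or_pos j with rfl | hj
  · exact trivial
  change (g - h).val ∈ nuPow R A j
  rw [← inr_mem_augIdeal_pow_iff hj] at hgh ⊢
  have h1 : (h + -h).toUnitization R = 1 := by rw [add_neg_cancel, OnePlus.toUnitization_zero]
  have h2 := OnePlus.toUnitization_add (R := R) g (-h)
  rw [OnePlus.toUnitization_add] at h1
  rw [← sub_eq_add_neg] at h2
  -- Multiplicatively, `g h⁻¹ - 1 = (g - h) h⁻¹`.
  have h3 : (((g - h).val : A) : Unitization R A) =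
      (((g.val - h.val : A)) : Unitization R A) * (-h).toUnitization R := by
    rw [Unitization.inr_sub]
    simp only [OnePlus.toUnitization] at h1 h2 ⊢
    linear_combination h2 + h1
  rw [h3]
  exact Ideal.mul_mem_right _ _ hgh

/-- The exponential and `1 + x` agree to leading order, so they induce the same identification of
the first pages. -/
theorem nilExp_sub_mem {R : Type} [CommRing R] {A : Type u} [NonUnitalCommRing A]
    [Module R A] [IsScalarTower R A A] [SMulCommClass R A A] (hp : 2 ≤ p)
    (h : nuPow R A (p + 1) = ⊥) {j : ℕ} {x : A} (hx : x ∈ nuPow R A j) {g : OnePlus A}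
    (hg : g.val = x) : nilExp h x - g ∈ onePlusPow R A (j + 1) := by
  rcases Nat.eq_zero_or_pos j with rfl | hj
  · exact trivial
  refine OnePlus.sub_mem_onePlusPow ?_
  have hv : (((nilExp h x).val : A) : Unitization R A) = truncExp R p (x : Unitization R A) - 1 :=
    eq_sub_of_add_eq' (toUnitization_nilExp hp h x)
  rw [hg, ← inr_mem_augIdeal_pow_iff (by omega), Unitization.inr_sub, hv]
  exact truncExp_sub_one_sub_mem hp (inr_mem_augIdeal x) ((inr_mem_augIdeal_pow_iff hj).2 hx)

theorem algExp_sub_mem (hp : 2 ≤ p) {i : ℕ} {j : ℤ} {x : (additiveFiltration 𝔪).X.obj (.mk i)}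
    (hx : x ∈ (additiveFiltration 𝔪).F j (.mk i)) {g : (multiplicativeFiltration 𝔪).X.obj (.mk i)}
    (hg : OnePlus.val (A := 𝔪.obj (.mk i)) g = x) :
    algExp 𝔪 h𝔪 i x - g ∈ (multiplicativeFiltration 𝔪).F (j + 1) (.mk i) :=
  (multiplicativeFiltration 𝔪).antitone (show j + 1 ≤ ((j.toNat + 1 : ℕ) : ℤ) by omega) _
    (nilExp_sub_mem hp (h𝔪 (.mk i)) (show x ∈ nuPow (ZInv p) (𝔪.obj (.mk i)) j.toNat from hx) hg)

/-- The identification of the pages given by the truncated exponential. -/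
noncomputable def expPageIdentification (hp : 2 ≤ p) : PageIdentification 𝔪 ((p : ℤ) - 1) where
  equiv r _ h₂ i j := (expComparison 𝔪 h𝔪 hp).pageEquiv (by omega) h₂ i j
  first h i j a b hab := by
    rw [Comparison.pageEquiv_mkE_eq_iff]
    exact FilteredCosimplicial.mem_B_of_mem_Z (FilteredCosimplicial.mem_Z_of_mem (j' := j + 1)
      (algExp_sub_mem 𝔪 h𝔪 hp a.2.1 hab) le_rfl (by omega))
  comm r h₁ h₂ i j j' hj e := (expComparison 𝔪 h𝔪 hp).pageEquiv_dE (by omega) h₂ i hj e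
  next r h₁ h₂ i j a b ha ha' hb hb' h :=
    (expComparison 𝔪 h𝔪 hp).pageEquiv_succ (by omega) h₂ i j a b ha ha' hb hb' h

end Main

end TruncExp

/-! ### The main theorem -/

open TruncExp in
theorem mainTheorem9 (p : ℕ) (hp : p.Prime) :
    ∃ (h₁ : ∀ (P : CosimplicialObject (ModuleCat.{u} (ZInv p))) (i : ℕ),
        ∀ x ∈ cocycles (toAb P) i, phi p P i x ∈ cocycles (toAb (symPow p P)) (i + 1))
      (h₂ : ∀ (P : CosimplicialObject (ModuleCat.{u} (ZInv p))) (i : ℕ),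
        ∀ x ∈ cocycles (toAb P) i, ∀ y ∈ cocycles (toAb P) i,
          x - y ∈ coboundaries (toAb P) i →
            phi p P i x - phi p P i y ∈ coboundaries (toAb (symPow p P)) (i + 1)),
      ∀ (𝔪 : CosimplicialObject (NUCommAlg.{u} (ZInv p)))
        (h𝔪 : ∀ n, nuPow (ZInv p) (𝔪.obj n) (p + 1) = ⊥),
        ∃ θ : PageIdentification 𝔪 ((p : ℤ) - 1),
          ∀ (i : ℕ) (e : (additiveFiltration 𝔪).E ((p : ℤ) - 1) i 1),
            have hr : 1 ≤ (p : ℤ) - 1 := by have := hp.two_le; omega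
            (multiplicativeFiltration 𝔪).dE ((p : ℤ) - 1) i 1 p (by ring)
                (θ.equiv ((p : ℤ) - 1) hr le_rfl i 1 e) =
              θ.equiv ((p : ℤ) - 1) hr le_rfl (i + 1) p
                ((additiveFiltration 𝔪).dE ((p : ℤ) - 1) i 1 p (by ring) e +
                  topEdge 𝔪 ((p : ℤ) - 1) hr (i + 1) p
                    (Coh.map (toAbMap (mulMap 𝔪 h𝔪)) (i + 1)
                      (phiCoh (h₁ (indec 𝔪) i) (h₂ (indec 𝔪) i)
                        (bottomEdge 𝔪 ((p : ℤ) - 1) hr i e)))) := by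
  have hp0 : 0 < p := hp.pos
  refine ⟨fun P i => phi_mem_cocycles hp0 i,
    fun P i x _ y _ => phi_sub_phi_mem_coboundaries hp0 i x y, fun 𝔪 h𝔪 =>
      ⟨expPageIdentification 𝔪 h𝔪 hp.two_le, fun i e => ?_⟩⟩
  obtain ⟨x, rfl⟩ := FilteredCosimplicial.mkE_surjective _ i 1 e
  have hq : 1 ≤ (p : ℤ) - 1 := by have := hp.two_le; omega
  -- On the class of `x`, the composite of the edge maps with `φ` is by definition the class of
  -- `algPhi x`, the error term of the comparison.
  exact (expComparison 𝔪 h𝔪 hp.two_le).dE_pageEquiv hq le_rfl i (by ring) x
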